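/- **Setting.** Let $N\ge 1$, $M\ge 0$, $\mathcal I=\{1,\dots,N\}$, $\mathcal J=\{1,\dots,M\}$, and let $H\in\mathbb F_2^{M\times N}$ be a parity-check matrix, with $\mathcal N(j)=\{i: H_{ji}\neq0\}$, $\mathcal N(i)=\{j:H_{ji}\ne 0\}$ and $\mathcal E_j=\{\mathcal B\subseteq\mathcal N(j): |\mathcal B|\text{ even}\}$; assume that no row of $H$ has weight exactly $1$. Consider a length-$N$ trellis of a binary-input finite-state channel: a finite state set $\mathcal S$, finite edge sets $\mathcal T_1,\dots,\mathcal T_N$, each edge $e$ having an initial state $s(e)$, a final state $s'(e)$ and an input bit $x(e)\in\{0,1\}$, and real branch metrics $b_{i,e}$ ($e\in\mathcal T_i$; edges of infinite metric are left out of $\mathcal T_i$). Assume that every input sequence in $\{0,1\}^N$ labels at least one trellis path. *Problem-P:* minimize $c(\mathbf g)=\sum_i\sum_{e\in\mathcal T_i}b_{i,e}g_{i,e}$ over $\mathbf g,\mathbf w\ge0$ subject to $\sum_{\mathcal B\in\mathcal E_j}w_{j,\mathcal B}=1$ for all $j$; $\sum_{e\in\mathcal T_p}g_{p,e}=1$ for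 all $p$; $\sum_{\mathcal B\in\mathcal E_j,\mathcal B\ni i}w_{j,\mathcal B}=\sum_{e\in\mathcal T_i:x(e)=1}g_{i,e}$ for all $i$ and $j\in\mathcal N(i)$; and $\sum_{e\in\mathcal T_i:s'(e)=k}g_{i,e}=\sum_{e\in\mathcal T_{i+1}:s(e)=k}g_{i+1,e}$ for all $i<N$, $k\in\mathcal S$. Its minimum is $P^*$. *Problem-DS* (for $K_1,K_2>0$ and $p\in\mathcal I$): maximize over $\mathbf m=(m_{i,j})$ $$-\frac1{K_1}\sum_j\ln\sum_{\mathcal B\in\mathcal E_j}e^{-K_1\sum_{i\in\mathcal B}m_{i,j}}-\frac1{K_2}\ln\sum_{e\in\mathcal T_p}e^{-K_2\{\Gamma_{p,e}-\overrightarrow n_{p-1,s(e)}+\overleftarrow n_{p,s'(e)}\}},$$ where $\Gamma_{i,e}=b_{i,e}-\delta_{x(e)=1}\sum_{j\in\mathcal N(i)}m_{i,j}$, $\overrightarrow n_{0,k}=\overleftarrow n_{N,k}=0$, $e^{K_2\overrightarrow n_{i,k}}=\sum_{e\in\mathcal T_i:s'(e)=k}e^{-K_2\{\Gamma_{i,e}-\overrightarrow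 n_{i-1,s(e)}\}}$ and $e^{-K_2\overleftarrow n_{i,k}}=\sum_{e\in\mathcal T_{i+1}:s(e)=k}e^{-K_2\{\Gamma_{i+1,e}+\overleftarrow n_{i+1,s'(e)}\}}$ (an empty sum is $0=e^{-\infty}$). *Problem-PS:* minimize $c(\mathbf g)-\frac1{K_1}\sum_jH(w_j)-\frac1{K_2}H_{\mathcal T}(\mathbf g)$ subject to the constraints of Problem-P, where $H(x)=-\sum_ix_i\ln x_i$ and $H_{\mathcal T}(\mathbf g)=\sum_{i=1}^NH(g_i)-\sum_{i=1}^{N-1}H(\sigma_i)$, $\sigma_i(k)=\sum_{e\in\mathcal T_i:s'(e)=k}g_{i,e}$, is the entropy of the trellis flow. *Problem-PS$_p$* is the same problem with $H_{\mathcal T}(\mathbf g)$ replaced by the single-section entropy $H(g_p)$. *Modified Algorithm 1.* Start from $\mathbf m=0$. One iteration treats $p=1,\dots,N$ in turn: with $\lambda_{i,e}=e^{-K_2\Gamma_{i,e}}$ computed from the current $\mathbf m$, let $\alpha_0=\beta_N\equiv1/|\mathcal S|$, $\alpha_i(k)\propto\sum_{e\in\mathcal T_i:s'(e)=k}\alpha_{i-1}(s(e))\lambda_{i,e}$,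 $\beta_{i-1}(k)\propto\sum_{e\in\mathcal T_i:s(e)=k}\beta_i(s'(e))\lambda_{i,e}$ (normalized over $k$), $$\gamma_p=\ln\frac{\sum_{e\in\mathcal T_p:x(e)=0}\alpha_{p-1}(s(e))\lambda_{p,e}\beta_p(s'(e))}{\sum_{e\in\mathcal T_p:x(e)=1}\alpha_{p-1}(s(e))\lambda_{p,e}\beta_p(s'(e))},$$ and replace $m_{p,j}$, for all $j\in\mathcal N(p)$, by $\frac1{K_1}\ln\frac{1-l_{p,j}}{1+l_{p,j}}+\frac{\gamma_p}{K_1}$, where $l_{p,j}=\prod_{r\in\mathcal N(j)\setminus p}\tanh(K_1m_{r,j}/2)$. Let $\mathbf m^{(\ell)}$ be the messages after $\ell$ iterations, and let $g^{(\ell)}_{i,e}\propto\alpha_{i-1}(s(e))\lambda_{i,e}\beta_i(s'(e))$ (normalized over $e\in\mathcal T_i$) and $w^{(\ell)}_{j,\mathcal B}\propto e^{-K_1\sum_{i\in\mathcal B}m_{i,j}}$ (normalized over $\mathcal B\in\mathcal E_j$) be computed from $\mathbf m^{(\ell)}$. **Theorem.** The minimum $P^*$ is attained. For every $\delta>0$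 there is $K_0>0$ such that for all $K_1,K_2\ge K_0$: 1. Problem-PS has a unique optimal solution $(\tilde{\mathbf g},\tilde{\mathbf w})$; it is feasible for Problem-P, and the minimum $P_S$ of Problem-PS equals the maximum of Problem-DS, which is attained, for every $p$. 2. With $\tilde P=c(\tilde{\mathbf g})$ the value of $\tilde{\mathbf g}$ in Problem-P, $\;0\le(\tilde P-P^*)/N\le\delta$. Moreover $0\le(P^*-P_S)/N\le\delta$. 3. If $|\mathcal N(i)|\,K_2<K_1$ for all $i$, then the modified Algorithm 1 converges and yields $\tilde{\mathbf g}$: as $\ell\to\infty$, the value of Problem-DS at $\mathbf m^{(\ell)}$ tends to its maximum, $\mathbf g^{(\ell)}\to\tilde{\mathbf g}$ and $\mathbf w^{(\ell)}\to\tilde{\mathbf w}$. If moreover no row of $H$ has weight $2$, then $\mathbf m^{(\ell)}$ converges to a maximizer of Problem-DS, and for all sufficiently large $\ell$ the vector $\mathbf g^{(\ell)}$ is itself feasible for Problem-P (together with some $\mathbf w$) and satisfies $0\le(c(\mathbf g^{(\ell)})-P^*)/N\le\delta$. 4. For every $p$, Problem-PS$_p$ has a minimum $P_p$ with $0\le(P^*-P_p)/N\le\delta$,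 and each of its optimal solutions $(\mathbf g,\mathbf w)$ satisfies $0\le(c(\mathbf g)-P^*)/N\le\delta$. -/

import Mathlib

open Filter Topology

noncomputable section

/-- Data of the joint decoding problem for a code of length `N` with `M` parity checks and the
length-`N` trellis of a binary-input finite-state channel with states `S` and edge labels `E`.
Only edges in `sec i` belong to the `i`-th trellis section, so edges of infinite cost
(probability zero, or a forbidden initial state) are simply left out of the section. -/
structure JointDecoding (N M : ℕ) (S E : Type*) where
  /-- parity-check matrix -/
  H : Matrix (Fin M) (Fin N) (ZMod 2)
  /-- the edges of each trellis section -/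
  sec : Fin N → Finset E
  /-- initial state of an edge -/
  src : E → S
  /-- final state of an edge -/
  dst : E → S
  /-- input bit of an edge (`true` is 1) -/
  inp : E → Bool
  /-- branch metric -/
  b : Fin N → E → ℝ

namespace JointDecoding

variable {N M : ℕ} {S E : Type*} [Fintype S] [DecidableEq S]

/-- The variable nodes adjacent to check `j`. -/
def checkNbr (D : JointDecoding N M S E) (j : Fin M) : Finset (Fin N) :=
  Finset.univ.filter fun i => D.H j i ≠ 0

/-- The check nodes adjacent to bit `i`. -/
def bitNbr (D : JointDecoding N M S E) (i : Fin N) : Finset (Fin M) :=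
  Finset.univ.filter fun j => D.H j i ≠ 0

/-- The valid local patterns of check `j`: subsets of its neighbourhood of even size. -/
def patterns (D : JointDecoding N M S E) (j : Fin M) : Finset (Finset (Fin N)) :=
  (D.checkNbr j).powerset.filter fun B => Even B.card

/-- A trellis path: one edge from each section, consecutive edges sharing a state. -/
def IsPath (D : JointDecoding N M S E) (ε : Fin N → E) : Prop :=
  (∀ i, ε i ∈ D.sec i) ∧
    ∀ (i : ℕ) (h : i + 1 < N), D.dst (ε ⟨i, Nat.lt_of_succ_lt h⟩) = D.src (ε ⟨i + 1, h⟩)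

/-- The channel can be driven by every binary input sequence. -/
def AcceptsAllInputs (D : JointDecoding N M S E) : Prop :=
  ∀ u : Fin N → Bool, ∃ ε : Fin N → E, D.IsPath ε ∧ ∀ i, D.inp (ε i) = u i

/-! ### The primal problems -/

/-- The feasible pairs `(g, w)` of Problem-P. The variables are `g i e` for `e ∈ sec i` and
`w j B` for `B ∈ patterns j`; all the other entries of the two arrays are fixed to be zero. -/
structure Feasible (D : JointDecoding N M S E)
    (x : (Fin N → E → ℝ) × (Fin M → Finset (Fin N) → ℝ)) : Prop where
  w_sum : ∀ j, ∑ B ∈ D.patterns j, x.2 j B = 1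
  g_sum : ∀ p, ∑ e ∈ D.sec p, x.1 p e = 1
  coupling : ∀ i, ∀ j ∈ D.bitNbr i,
    ∑ B ∈ D.patterns j with i ∈ B, x.2 j B = ∑ e ∈ D.sec i with D.inp e = true, x.1 i e
  flow : ∀ (i : ℕ) (h : i + 1 < N) (k : S),
    ∑ e ∈ D.sec ⟨i, Nat.lt_of_succ_lt h⟩ with D.dst e = k, x.1 ⟨i, Nat.lt_of_succ_lt h⟩ e =
      ∑ e ∈ D.sec ⟨i + 1, h⟩ with D.src e = k, x.1 ⟨i + 1, h⟩ e
  w_nonneg : ∀ j, ∀ B ∈ D.patterns j, 0 ≤ x.2 j B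
  g_nonneg : ∀ i, ∀ e ∈ D.sec i, 0 ≤ x.1 i e
  w_off : ∀ j, ∀ B, B ∉ D.patterns j → x.2 j B = 0
  g_off : ∀ i, ∀ e, e ∉ D.sec i → x.1 i e = 0

/-- The feasible set of Problem-P. -/
def feasibleSet (D : JointDecoding N M S E) :
    Set ((Fin N → E → ℝ) × (Fin M → Finset (Fin N) → ℝ)) :=
  {x | D.Feasible x}

/-- The objective of Problem-P. -/
def cost (D : JointDecoding N M S E) (g : Fin N → E → ℝ) : ℝ :=
  ∑ i, ∑ e ∈ D.sec i, D.b i e * g i e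

/-- The entropy of the local distribution `w j`. -/
def checkEntropy (D : JointDecoding N M S E) (w : Fin M → Finset (Fin N) → ℝ) (j : Fin M) : ℝ :=
  ∑ B ∈ D.patterns j, Real.negMulLog (w j B)

/-- The entropy of the edge distribution `g p` of one section. -/
def sectionEntropy (D : JointDecoding N M S E) (g : Fin N → E → ℝ) (p : Fin N) : ℝ :=
  ∑ e ∈ D.sec p, Real.negMulLog (g p e)

/-- The entropy of the state distribution at the end of section `i`. -/
def stateEntropy (D : JointDecoding N M S E) (g : Fin N → E → ℝ) (i : Fin N) : ℝ :=
  ∑ k : S, Real.negMulLog (∑ e ∈ D.sec i with D.dst e = k, g i e)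

/-- The entropy of the trellis flow `g`, that is, of the Markov chain of edges with marginals `g`:
`∑_i H(g_i) - ∑_{i < N} H(σ_i)`, with `σ_i` the state distribution between sections `i` and `i+1`.
For every section `p` it is `H(g_p)` plus the conditional entropies of the edges of the sections
before `p` given their final state and of those after `p` given their initial state. -/
def trellisEntropy (D : JointDecoding N M S E) (g : Fin N → E → ℝ) : ℝ :=
  ∑ i, D.sectionEntropy g i -
    ∑ i ∈ Finset.univ.filter (fun i : Fin N => (i : ℕ) + 1 < N), D.stateEntropy g i

/-- The objective of Problem-PS, in the form that is the Lagrangian dual of Problem-DS. -/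
def psObj (D : JointDecoding N M S E) (K₁ K₂ : ℝ)
    (x : (Fin N → E → ℝ) × (Fin M → Finset (Fin N) → ℝ)) : ℝ :=
  D.cost x.1 - 1 / K₁ * ∑ j, D.checkEntropy x.2 j - 1 / K₂ * D.trellisEntropy x.1

/-- The objective of the variant of Problem-PS that keeps, of the trellis entropy, only the
entropy of section `p`. -/
def psObjAt (D : JointDecoding N M S E) (K₁ K₂ : ℝ) (p : Fin N)
    (x : (Fin N → E → ℝ) × (Fin M → Finset (Fin N) → ℝ)) : ℝ :=
  D.cost x.1 - 1 / K₁ * ∑ j, D.checkEntropy x.2 j - 1 / K₂ * D.sectionEntropy x.1 p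

/-! ### The soft-min dual problem -/

/-- `Γ_{i,e} = b_{i,e} - δ_{x(e)=1} ∑_{j ∈ N(i)} m_{i,j}`. -/
def Gam (D : JointDecoding N M S E) (m : Fin N → Fin M → ℝ) (i : Fin N) (e : E) : ℝ :=
  D.b i e - if D.inp e = true then ∑ j ∈ D.bitNbr i, m i j else 0

/-- `λ_{i,e} = exp(-K₂ Γ_{i,e})`. -/
def lam (D : JointDecoding N M S E) (K₂ : ℝ) (m : Fin N → Fin M → ℝ) (i : Fin N) (e : E) : ℝ :=
  Real.exp (-K₂ * D.Gam m i e)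

/-- The forward soft-min recursion in exponential form: with `n⃗` the forward variable of
Problem-DS, `fwd i k = exp(K₂ n⃗_{i,k})`; it is zero (`n⃗_{i,k} = -∞`) at unreachable states. -/
def fwd (D : JointDecoding N M S E) (K₂ : ℝ) (m : Fin N → Fin M → ℝ) : ℕ → S → ℝ
  | 0, _ => 1
  | i + 1, k =>
    if h : i < N then
      ∑ e ∈ D.sec ⟨i, h⟩ with D.dst e = k, fwd D K₂ m i (D.src e) * D.lam K₂ m ⟨i, h⟩ e
    else 0

/-- The backward soft-min recursion in exponential form, by the number `r` of sections to the end: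
with `n⃖` the backward variable of Problem-DS, `bwdRev r k = exp(-K₂ n⃖_{N-r,k})`. -/
def bwdRev (D : JointDecoding N M S E) (K₂ : ℝ) (m : Fin N → Fin M → ℝ) : ℕ → S → ℝ
  | 0, _ => 1
  | r + 1, k =>
    if h : r < N then
      ∑ e ∈ D.sec ⟨N - 1 - r, by omega⟩ with D.src e = k,
        bwdRev D K₂ m r (D.dst e) * D.lam K₂ m ⟨N - 1 - r, by omega⟩ e
    else 0

/-- `bwd i k = exp(-K₂ n⃖_{i,k})`. -/
def bwd (D : JointDecoding N M S E) (K₂ : ℝ) (m : Fin N → Fin M → ℝ) (i : ℕ) : S → ℝ :=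
  D.bwdRev K₂ m (N - i)

/-- The objective of Problem-DS, written at section `p`. (Sections are numbered from zero, so
section `p` runs from the vertices of time `p` to those of time `p + 1`.) -/
def dsObj (D : JointDecoding N M S E) (K₁ K₂ : ℝ) (p : Fin N) (m : Fin N → Fin M → ℝ) : ℝ :=
  -(1 / K₁) * ∑ j, Real.log (∑ B ∈ D.patterns j,
      Real.exp (-K₁ * ∑ i ∈ D.checkNbr j, if i ∈ B then m i j else 0))
    - 1 / K₂ * Real.log (∑ e ∈ D.sec p,
      D.fwd K₂ m p (D.src e) * D.lam K₂ m p e * D.bwd K₂ m (p + 1) (D.dst e))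

/-! ### The algorithm with the cyclic schedule -/

/-- Normalized forward (BCJR) messages. -/
def alpha (D : JointDecoding N M S E) (K₂ : ℝ) (m : Fin N → Fin M → ℝ) : ℕ → S → ℝ
  | 0, _ => 1 / (Fintype.card S : ℝ)
  | i + 1, k =>
    if h : i < N then
      (∑ e ∈ D.sec ⟨i, h⟩ with D.dst e = k, alpha D K₂ m i (D.src e) * D.lam K₂ m ⟨i, h⟩ e) /
        ∑ k' : S, ∑ e ∈ D.sec ⟨i, h⟩ with D.dst e = k',
          alpha D K₂ m i (D.src e) * D.lam K₂ m ⟨i, h⟩ e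
    else 0

/-- Normalized backward (BCJR) messages, by the number of sections to the end. -/
def betaRev (D : JointDecoding N M S E) (K₂ : ℝ) (m : Fin N → Fin M → ℝ) : ℕ → S → ℝ
  | 0, _ => 1 / (Fintype.card S : ℝ)
  | r + 1, k =>
    if h : r < N then
      (∑ e ∈ D.sec ⟨N - 1 - r, by omega⟩ with D.src e = k,
        betaRev D K₂ m r (D.dst e) * D.lam K₂ m ⟨N - 1 - r, by omega⟩ e) /
        ∑ k' : S, ∑ e ∈ D.sec ⟨N - 1 - r, by omega⟩ with D.src e = k',
          betaRev D K₂ m r (D.dst e) * D.lam K₂ m ⟨N - 1 - r, by omega⟩ e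
    else 0

/-- Normalized backward (BCJR) messages. -/
def beta (D : JointDecoding N M S E) (K₂ : ℝ) (m : Fin N → Fin M → ℝ) (i : ℕ) : S → ℝ :=
  D.betaRev K₂ m (N - i)

/-- The unnormalized BCJR belief of an edge. -/
def edgeWeight (D : JointDecoding N M S E) (K₂ : ℝ) (m : Fin N → Fin M → ℝ)
    (i : Fin N) (e : E) : ℝ :=
  D.alpha K₂ m i (D.src e) * D.lam K₂ m i e * D.beta K₂ m (i + 1) (D.dst e)

/-- The trellis-to-bit message. -/
def gam (D : JointDecoding N M S E) (K₂ : ℝ) (m : Fin N → Fin M → ℝ) (i : Fin N) : ℝ :=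
  Real.log ((∑ e ∈ D.sec i with D.inp e = false, D.edgeWeight K₂ m i e) /
    ∑ e ∈ D.sec i with D.inp e = true, D.edgeWeight K₂ m i e)

/-- The product of hyperbolic tangents in the check-to-bit message. -/
def ell (D : JointDecoding N M S E) (K₁ : ℝ) (m : Fin N → Fin M → ℝ) (i : Fin N) (j : Fin M) : ℝ :=
  ∏ r ∈ (D.checkNbr j).erase i, Real.tanh (K₁ * m r j / 2)

/-- The check-to-bit message. -/
def checkMsg (D : JointDecoding N M S E) (K₁ : ℝ) (m : Fin N → Fin M → ℝ)
    (i : Fin N) (j : Fin M) : ℝ :=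
  1 / K₁ * Real.log ((1 - D.ell K₁ m i j) / (1 + D.ell K₁ m i j))

/-- One update of the cyclic schedule: compute the trellis-to-bit message of bit `p` from the
current messages, then replace `m p j` for the checks `j` adjacent to `p`. -/
def bitUpdate (D : JointDecoding N M S E) (K₁ K₂ : ℝ) (p : Fin N) (m : Fin N → Fin M → ℝ) :
    Fin N → Fin M → ℝ :=
  fun i j => if i = p ∧ j ∈ D.bitNbr p then D.checkMsg K₁ m p j + D.gam K₂ m p / K₁ else m i j

/-- One iteration: update the bits in cyclic order, each from the messages left by its
predecessor. -/
def sweep (D : JointDecoding N M S E) (K₁ K₂ : ℝ) (m : Fin N → Fin M → ℝ) : Fin N → Fin M → ℝ :=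
  (List.finRange N).foldl (fun m' p => D.bitUpdate K₁ K₂ p m') m

/-- The messages after `l` iterations, started from `m = 0`. -/
def iter (D : JointDecoding N M S E) (K₁ K₂ : ℝ) (l : ℕ) : Fin N → Fin M → ℝ :=
  (D.sweep K₁ K₂)^[l] 0

open Classical in
/-- The primal edge variables obtained from messages `m`: the normalized BCJR edge beliefs. -/
def gOf (D : JointDecoding N M S E) (K₂ : ℝ) (m : Fin N → Fin M → ℝ) (i : Fin N) (e : E) : ℝ :=
  if e ∈ D.sec i then D.edgeWeight K₂ m i e / ∑ e' ∈ D.sec i, D.edgeWeight K₂ m i e' else 0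

/-- The primal pattern variables obtained from messages `m`: the local beliefs of the checks. -/
def wOf (D : JointDecoding N M S E) (K₁ : ℝ) (m : Fin N → Fin M → ℝ)
    (j : Fin M) (B : Finset (Fin N)) : ℝ :=
  if B ∈ D.patterns j then
    Real.exp (-K₁ * ∑ i ∈ B, m i j) / ∑ B' ∈ D.patterns j, Real.exp (-K₁ * ∑ i ∈ B', m i j)
  else 0

end JointDecoding

end

/-! ### Entropy inequalities -/

/-! Problem-PS is an entropic regularization of a linear program, and Problem-DS is its Lagrangian
dual. Every log-partition function in the dual obeys a Gibbs variational principle. For a check this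
is the log-sum inequality (`check_gibbs`). For the trellis it is the chain rule: one log-sum
inequality per section, with the backward variables as potentials (`IsFlow.trellisEntropy_add_le`).
On feasible points the message terms cancel, so the duality gap is a sum of Gibbs defects, which
vanishes exactly when the point consists of the normalized beliefs (`Feasible.dual_le`).

The dual attains its maximum because it is coercive in the natural parameters, the linear
functionals of the messages on which the beliefs depend (`exists_bound_natParam`). Moving a single
message shows that a maximizer equalizes the check and trellis logits of each bit. This is the
coupling constraint, so the beliefs at a maximizer are feasible, which gives strong duality and the
unique optimal solution. The closeness to Problem-P only uses that the entropies are bounded, so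
that `1 / K₁` and `1 / K₂` times them are small.

A bit update moves every adjacent check logit onto the old trellis logit. Its gain in the dual is a
Jensen defect of the strictly convex function `softplus`, with weight `K₂ / K₁` per check; the
condition `|N(i)| K₂ < K₁` leaves positive weight at the trellis logit. The dual therefore increases
strictly unless the messages are stationary (`dual_le_sweep`). Compactness modulo the kernel of
`natParam` turns this into convergence of all quantities that are constant on stationary messages
(`tendsto_iter`).

If every nonempty check has at least three bits, pair sums determine the messages, and bit marginals
can be corrected one at a time. This gives convergence of the messages and exact feasibility after
finitely many iterations. -/

/-- The tangent bound `log x ≤ x - 1` at `x = q / a`, multiplied by `a`. The support hypothesis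
excludes `q = 0 < a`, where the convention `Real.log 0 = 0` would break the inequality. -/
theorem negMulLog_add_mul_log_le {a q : ℝ} (ha : 0 ≤ a) (hq : 0 ≤ q) (h : q = 0 → a = 0) :
    Real.negMulLog a + a * Real.log q ≤ q - a ∧
      (Real.negMulLog a + a * Real.log q = q - a ↔ a = q) := by
  rcases ha.eq_or_lt with rfl | ha
  · simp [hq, eq_comm]
  have hq : 0 < q := lt_of_le_of_ne hq fun h' => ha.ne' (h h'.symm)
  have key : Real.negMulLog a + a * Real.log q = a * Real.log (q / a) := by
    rw [Real.negMulLog, Real.log_div hq.ne' ha.ne']; ring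
  have hsub : q - a = a * (q / a - 1) := by field_simp
  rw [key, hsub]
  refine ⟨mul_le_mul_of_nonneg_left (Real.log_le_sub_one_of_pos (by positivity)) ha.le, ?_, ?_⟩
  · intro he
    by_contra hne
    have h1 : q / a ≠ 1 := fun h1 => hne ((div_eq_one_iff_eq ha.ne').1 h1).symm
    exact (mul_lt_mul_of_pos_left (Real.log_lt_sub_one_of_pos (by positivity) h1) ha).ne he
  · rintro rfl
    simp [ha.ne']

/-- The log-sum inequality, with its case of equality. -/
theorem sum_negMulLog_add_mul_log_le {ι : Type*} (s : Finset ι) (a c : ι → ℝ)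
    (ha : ∀ e ∈ s, 0 ≤ a e) (hc : ∀ e ∈ s, 0 ≤ c e) (h0 : ∀ e ∈ s, c e = 0 → a e = 0) :
    ∑ e ∈ s, (Real.negMulLog (a e) + a e * Real.log (c e)) ≤
        Real.negMulLog (∑ e ∈ s, a e) + (∑ e ∈ s, a e) * Real.log (∑ e ∈ s, c e) ∧
      (∑ e ∈ s, (Real.negMulLog (a e) + a e * Real.log (c e)) =
          Real.negMulLog (∑ e ∈ s, a e) + (∑ e ∈ s, a e) * Real.log (∑ e ∈ s, c e) ↔
        ∀ e ∈ s, a e * ∑ e' ∈ s, c e' = (∑ e' ∈ s, a e') * c e) := by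
  set A := ∑ e ∈ s, a e with hA
  set C := ∑ e ∈ s, c e with hC
  rcases (Finset.sum_nonneg ha).eq_or_lt with hA0 | hApos
  · have hz : ∀ e ∈ s, a e = 0 := (Finset.sum_eq_zero_iff_of_nonneg ha).1 hA0.symm
    have hA' : A = 0 := hA0.symm
    rw [hA', Finset.sum_congr rfl fun e he => by rw [hz e he]]
    simp +contextual [hz]
  have hApos : 0 < A := hApos
  have hCpos : 0 < C := by
    obtain ⟨e, he, hpos⟩ := (Finset.sum_pos_iff_of_nonneg ha).1 hApos
    exact (Finset.sum_pos_iff_of_nonneg hc).2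
      ⟨e, he, lt_of_le_of_ne (hc e he) fun h => hpos.ne' (h0 e he h.symm)⟩
  -- Rescaling `c` to total mass `A` makes the tangent errors `A * c e / C - a e` add up to zero.
  have hterm : ∀ e ∈ s, Real.negMulLog (a e) + a e * Real.log (c e) =
      (Real.negMulLog (a e) + a e * Real.log (A * c e / C)) -
        a e * (Real.log A - Real.log C) := by
    intro e he
    by_cases hce : c e = 0
    · simp [h0 e he hce]
    · rw [Real.log_div (by positivity) hCpos.ne', Real.log_mul hApos.ne' hce]; ring
  have hq : ∑ e ∈ s, A * c e / C = A := by
    rw [← Finset.sum_div, ← Finset.mul_sum, ← hC]; field_simp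
  have hG := fun e (he : e ∈ s) => negMulLog_add_mul_log_le (q := A * c e / C) (ha e he)
    (by have := hc e he; positivity) (fun h => h0 e he (by
      rcases div_eq_zero_iff.1 h with h | h
      · exact (mul_eq_zero.1 h).resolve_left hApos.ne'
      · exact absurd h hCpos.ne'))
  have hsum : ∑ e ∈ s, (A * c e / C - a e) = 0 := by
    rw [Finset.sum_sub_distrib, hq, ← hA, sub_self]
  have hle := Finset.sum_le_sum fun e he => (hG e he).1
  rw [Finset.sum_congr rfl hterm, Finset.sum_sub_distrib, ← Finset.sum_mul, ← hA]
  have hA' : Real.negMulLog A = - A * Real.log A := rfl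
  refine ⟨by rw [hA']; linarith, ?_⟩
  have h1 : (∑ e ∈ s, (Real.negMulLog (a e) + a e * Real.log (A * c e / C)) -
      A * (Real.log A - Real.log C) = Real.negMulLog A + A * Real.log C) ↔
      ∑ e ∈ s, (Real.negMulLog (a e) + a e * Real.log (A * c e / C)) =
        ∑ e ∈ s, (A * c e / C - a e) := by
    rw [hsum, hA']; constructor <;> intro h <;> linarith
  rw [h1, Finset.sum_eq_sum_iff_of_le fun e he => (hG e he).1]
  refine forall₂_congr fun e he => ?_
  rw [(hG e he).2, eq_div_iff hCpos.ne']

theorem negMulLog_le_one {x : ℝ} (hx : 0 ≤ x) : Real.negMulLog x ≤ 1 := by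
  have := (negMulLog_add_mul_log_le (q := 1) hx zero_le_one (by simp)).1
  simp at this; linarith

/-- Merging the atoms of a subprobability vector does not increase its entropy. -/
theorem negMulLog_sum_le {ι : Type*} (s : Finset ι) (a : ι → ℝ) (ha : ∀ e ∈ s, 0 ≤ a e) :
    Real.negMulLog (∑ e ∈ s, a e) ≤ ∑ e ∈ s, Real.negMulLog (a e) := by
  rw [Real.negMulLog, neg_mul, Finset.sum_mul, ← Finset.sum_neg_distrib]
  refine Finset.sum_le_sum fun e he => ?_
  rw [Real.negMulLog, neg_mul]
  rcases (ha e he).eq_or_lt with h | h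
  · simp [← h]
  · exact neg_le_neg (mul_le_mul_of_nonneg_left
      (Real.log_le_log h (Finset.single_le_sum ha he)) h.le)

/-! ### The softplus function -/

/-- The function `u ↦ log (1 + exp (-u))`. -/
noncomputable def softplus (u : ℝ) : ℝ := Real.log (1 + Real.exp (-u))

theorem strictConvexOn_softplus : StrictConvexOn ℝ Set.univ softplus := by
  have hd : ∀ u, HasDerivAt softplus (-(1 + Real.exp u)⁻¹) u := by
    intro u
    have h1 : HasDerivAt (fun u : ℝ => 1 + Real.exp (-u)) (-Real.exp (-u)) u := by
      simpa using ((hasDerivAt_neg u).exp).const_add 1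
    have h2 : HasDerivAt softplus (-Real.exp (-u) / (1 + Real.exp (-u))) u :=
      h1.log (by positivity)
    convert h2 using 1
    rw [Real.exp_neg]
    have := Real.exp_pos u
    field_simp
    ring
  refine StrictMonoOn.strictConvexOn_of_deriv convex_univ
    (fun u _ => (hd u).continuousAt.continuousWithinAt) ?_
  intro x _ y _ hxy
  rw [(hd x).deriv, (hd y).deriv]
  have := Real.exp_pos x
  exact neg_lt_neg (inv_strictAnti₀ (by positivity) (by
    have := Real.exp_lt_exp.2 hxy; linarith))

/-- Writes a binary log-partition function in terms of its logit: when only `y` is rescaled, just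
the argument of `softplus` moves. -/
theorem log_add_eq_softplus {x y : ℝ} (hx : 0 < x) (hy : 0 < y) :
    Real.log (x + y) = Real.log x + softplus (Real.log (x / y)) := by
  rw [softplus, Real.exp_neg, Real.exp_log (by positivity), ← Real.log_mul hx.ne' (by positivity)]
  congr 1
  field_simp

/-- Jensen's inequality for the softplus function with a total weight less than one on `s` and the
rest at `y`. -/
theorem softplus_relaxed {ι : Type*} (s : Finset ι) (t : ι → ℝ) (y r : ℝ) (hr : 0 < r)
    (hs : s.card * r < 1) :
    softplus (y - r * ∑ j ∈ s, (y - t j)) ≤ softplus y + r * ∑ j ∈ s, (softplus (t j) - softplus y) ∧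
      (softplus (y - r * ∑ j ∈ s, (y - t j)) =
          softplus y + r * ∑ j ∈ s, (softplus (t j) - softplus y) → ∀ j ∈ s, t j = y) := by
  -- The extra index `none` carries the leftover weight, positive by `hs`, at the point `y`. In the
  -- case of equality it ties every `t j` to `y`.
  let w : Option ι → ℝ := fun o => o.elim (1 - s.card * r) fun _ => r
  let z : Option ι → ℝ := fun o => o.elim y t
  have hw : ∀ i ∈ s.insertNone, 0 < w i := by
    rintro (_ | i) _
    · simpa [w] using hs
    · exact hr
  have hw1 : ∑ i ∈ s.insertNone, w i = 1 := by
    rw [Finset.sum_insertNone]; simp [w]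
  have e1 : ∑ i ∈ s.insertNone, w i • z i = y - r * ∑ j ∈ s, (y - t j) := by
    rw [Finset.sum_insertNone]
    simp only [w, z, Option.elim, smul_eq_mul, Finset.sum_sub_distrib, Finset.sum_const,
      nsmul_eq_mul, ← Finset.mul_sum]
    ring
  have e2 : ∑ i ∈ s.insertNone, w i • softplus (z i) =
      softplus y + r * ∑ j ∈ s, (softplus (t j) - softplus y) := by
    rw [Finset.sum_insertNone]
    simp only [w, z, Option.elim, smul_eq_mul, Finset.sum_sub_distrib, Finset.sum_const,
      nsmul_eq_mul, ← Finset.mul_sum]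
    ring
  refine ⟨?_, fun h j hj => ?_⟩
  · rw [← e1, ← e2]
    exact strictConvexOn_softplus.convexOn.map_sum_le (fun i hi => (hw i hi).le) hw1
      fun _ _ => Set.mem_univ _
  · rw [← e1, ← e2] at h
    have h' := (strictConvexOn_softplus.map_sum_eq_iff hw hw1 fun _ _ => Set.mem_univ _).1 h
    have hj' := h' (some j) (by simpa using hj)
    have hn := h' none (by simp)
    exact hj'.trans hn.symm

/-! ### Parity sums and linear lifts -/

theorem sum_even_add_sum_odd {ι : Type*} (s : Finset ι) (a : ι → ℝ) :
    ∑ B ∈ s.powerset with Even B.card, ∏ i ∈ B, a i +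
      ∑ B ∈ s.powerset with ¬ Even B.card, ∏ i ∈ B, a i = ∏ i ∈ s, (1 + a i) := by
  classical
  rw [Finset.sum_filter_add_sum_filter_not, Finset.prod_one_add]

/-- Replacing `a` by `-a` in the product expansion gives each subset the sign of its parity. Sum and
difference together isolate the even and the odd subsets. -/
theorem sum_even_sub_sum_odd {ι : Type*} (s : Finset ι) (a : ι → ℝ) :
    ∑ B ∈ s.powerset with Even B.card, ∏ i ∈ B, a i -
      ∑ B ∈ s.powerset with ¬ Even B.card, ∏ i ∈ B, a i = ∏ i ∈ s, (1 - a i) := by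
  classical
  simp only [sub_eq_add_neg (1 : ℝ)]
  rw [← sum_even_add_sum_odd s fun i => -a i, sub_eq_add_neg, ← Finset.sum_neg_distrib]
  congr 1 <;> refine Finset.sum_congr rfl fun B hB => ?_
  · rw [Finset.prod_neg, (Finset.mem_filter.1 hB).2.neg_one_pow, one_mul]
  · rw [Finset.prod_neg, (Nat.not_even_iff_odd.1 (Finset.mem_filter.1 hB).2).neg_one_pow,
      neg_one_mul]

/-- Points in the image of a linear map have preimages of comparable norm. -/
theorem LinearMap.exists_bounded_lift {V W : Type*} [NormedAddCommGroup V] [NormedSpace ℝ V]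
    [NormedAddCommGroup W] [NormedSpace ℝ W] [FiniteDimensional ℝ W] (A : V →ₗ[ℝ] W) :
    ∃ C : ℝ, ∀ v, ∃ u, A u = A v ∧ ‖u‖ ≤ C * ‖A v‖ := by
  obtain ⟨R, hR⟩ := A.rangeRestrict.exists_rightInverse_of_surjective A.range_rangeRestrict
  let R' := LinearMap.toContinuousLinearMap R
  refine ⟨‖R'‖, fun v => ⟨R' (A.rangeRestrict v), ?_, R'.le_opNorm _⟩⟩
  have := LinearMap.congr_fun hR (A.rangeRestrict v)
  exact congrArg Subtype.val this

namespace JointDecoding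

set_option linter.unusedSectionVars false

variable {N M : ℕ} {S E : Type*} [Fintype S] [DecidableEq S]

/-! ### The forward and backward recursions -/

theorem lam_pos (D : JointDecoding N M S E) (K₂ : ℝ) (m : Fin N → Fin M → ℝ) (i : Fin N) (e : E) :
    0 < D.lam K₂ m i e := Real.exp_pos _

theorem fwd_succ (D : JointDecoding N M S E) (K₂ : ℝ) (m : Fin N → Fin M → ℝ) (i : Fin N) (k : S) :
    D.fwd K₂ m (i + 1) k =
      ∑ e ∈ D.sec i with D.dst e = k, D.fwd K₂ m i (D.src e) * D.lam K₂ m i e := by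
  rw [fwd, dif_pos i.2]

theorem bwd_last (D : JointDecoding N M S E) (K₂ : ℝ) (m : Fin N → Fin M → ℝ) (k : S) :
    D.bwd K₂ m N k = 1 := by
  rw [bwd, Nat.sub_self, bwdRev]

theorem bwd_eq_sum (D : JointDecoding N M S E) (K₂ : ℝ) (m : Fin N → Fin M → ℝ) (i : Fin N)
    (k : S) :
    D.bwd K₂ m i k =
      ∑ e ∈ D.sec i with D.src e = k, D.bwd K₂ m (i + 1) (D.dst e) * D.lam K₂ m i e := by
  -- The recursion counts sections from the end: section `i` is processed after the `N - 1 - i`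
  -- sections that follow it.
  have h1 : N - (i : ℕ) = (N - 1 - i) + 1 := by omega
  have h2 : (⟨N - 1 - (N - 1 - i), by omega⟩ : Fin N) = i := Fin.ext (by simp; omega)
  have h3 : N - ((i : ℕ) + 1) = N - 1 - i := by omega
  rw [bwd, bwd, h1, bwdRev, dif_pos (by omega), h2, h3]

theorem alpha_succ (D : JointDecoding N M S E) (K₂ : ℝ) (m : Fin N → Fin M → ℝ) (i : Fin N)
    (k : S) :
    D.alpha K₂ m (i + 1) k =
      (∑ e ∈ D.sec i with D.dst e = k, D.alpha K₂ m i (D.src e) * D.lam K₂ m i e) /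
        ∑ e ∈ D.sec i, D.alpha K₂ m i (D.src e) * D.lam K₂ m i e := by
  rw [alpha, dif_pos i.2, Finset.sum_fiberwise]

theorem beta_last (D : JointDecoding N M S E) (K₂ : ℝ) (m : Fin N → Fin M → ℝ) (k : S) :
    D.beta K₂ m N k = 1 / (Fintype.card S : ℝ) := by
  rw [beta, Nat.sub_self, betaRev]

theorem beta_eq_div (D : JointDecoding N M S E) (K₂ : ℝ) (m : Fin N → Fin M → ℝ) (i : Fin N)
    (k : S) :
    D.beta K₂ m i k =
      (∑ e ∈ D.sec i with D.src e = k, D.beta K₂ m (i + 1) (D.dst e) * D.lam K₂ m i e) /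
        ∑ e ∈ D.sec i, D.beta K₂ m (i + 1) (D.dst e) * D.lam K₂ m i e := by
  have h1 : N - (i : ℕ) = (N - 1 - i) + 1 := by omega
  have h2 : (⟨N - 1 - (N - 1 - i), by omega⟩ : Fin N) = i := Fin.ext (by simp; omega)
  have h3 : N - ((i : ℕ) + 1) = N - 1 - i := by omega
  rw [beta, beta, h1, betaRev, dif_pos (by omega), h2, h3, Finset.sum_fiberwise]

theorem fwd_nonneg (D : JointDecoding N M S E) (K₂ : ℝ) (m : Fin N → Fin M → ℝ) (i : ℕ) (k : S) :
    0 ≤ D.fwd K₂ m i k := by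
  induction i generalizing k with
  | zero => exact zero_le_one
  | succ i ih =>
    rw [fwd]
    split_ifs
    · exact Finset.sum_nonneg fun e _ => mul_nonneg (ih _) (D.lam_pos _ _ _ _).le
    · exact le_rfl

theorem bwd_nonneg (D : JointDecoding N M S E) (K₂ : ℝ) (m : Fin N → Fin M → ℝ) (i : ℕ) (k : S) :
    0 ≤ D.bwd K₂ m i k := by
  rw [bwd]
  generalize N - i = r
  induction r generalizing k with
  | zero => exact zero_le_one
  | succ i ih =>
    rw [bwdRev]
    split_ifs
    · exact Finset.sum_nonneg fun e _ => mul_nonneg (ih _) (D.lam_pos _ _ _ _).le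
    · exact le_rfl

/-- The unnormalized belief of an edge, in terms of the soft-min recursions. -/
noncomputable def weight (D : JointDecoding N M S E) (K₂ : ℝ) (m : Fin N → Fin M → ℝ) (i : Fin N)
    (e : E) : ℝ :=
  D.fwd K₂ m i (D.src e) * D.lam K₂ m i e * D.bwd K₂ m (i + 1) (D.dst e)

theorem weight_nonneg (D : JointDecoding N M S E) (K₂ : ℝ) (m : Fin N → Fin M → ℝ) (i : Fin N)
    (e : E) : 0 ≤ D.weight K₂ m i e :=
  mul_nonneg (mul_nonneg (D.fwd_nonneg _ _ _ _) (D.lam_pos _ _ _ _).le) (D.bwd_nonneg _ _ _ _)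

/-- The partition function of the trellis. -/
noncomputable def partition (D : JointDecoding N M S E) (K₂ : ℝ) (m : Fin N → Fin M → ℝ) : ℝ :=
  ∑ k : S, D.bwd K₂ m 0 k

theorem sum_weight_src (D : JointDecoding N M S E) (K₂ : ℝ) (m : Fin N → Fin M → ℝ) (i : Fin N)
    (k : S) :
    ∑ e ∈ D.sec i with D.src e = k, D.weight K₂ m i e = D.fwd K₂ m i k * D.bwd K₂ m i k := by
  rw [bwd_eq_sum, Finset.mul_sum]
  refine Finset.sum_congr rfl fun e he => ?_
  rw [weight, (Finset.mem_filter.1 he).2]; ring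

theorem sum_weight_dst (D : JointDecoding N M S E) (K₂ : ℝ) (m : Fin N → Fin M → ℝ) (i : Fin N)
    (k : S) :
    ∑ e ∈ D.sec i with D.dst e = k, D.weight K₂ m i e =
      D.fwd K₂ m (i + 1) k * D.bwd K₂ m (i + 1) k := by
  rw [fwd_succ, Finset.sum_mul]
  refine Finset.sum_congr rfl fun e he => ?_
  rw [weight, (Finset.mem_filter.1 he).2]

/-- The edge weights of a section can be grouped by initial or by final state, so the total does not
change from one time to the next. -/
theorem sum_fwd_mul_bwd (D : JointDecoding N M S E) (K₂ : ℝ) (m : Fin N → Fin M → ℝ) (i : ℕ)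
    (hi : i ≤ N) : ∑ k : S, D.fwd K₂ m i k * D.bwd K₂ m i k = D.partition K₂ m := by
  induction i with
  | zero => exact Finset.sum_congr rfl fun k _ => by rw [fwd, one_mul]
  | succ i ih =>
    rw [← ih (by omega)]
    have h1 := fun k => D.sum_weight_dst K₂ m ⟨i, hi⟩ k
    have h2 := fun k => D.sum_weight_src K₂ m ⟨i, hi⟩ k
    simp only at h1 h2
    simp only [← h1, ← h2, Finset.sum_fiberwise]

theorem sum_weight (D : JointDecoding N M S E) (K₂ : ℝ) (m : Fin N → Fin M → ℝ) (i : Fin N) :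
    ∑ e ∈ D.sec i, D.weight K₂ m i e = D.partition K₂ m := by
  rw [← D.sum_fwd_mul_bwd K₂ m i i.2.le, ← Finset.sum_fiberwise (D.sec i) D.src]
  exact Finset.sum_congr rfl fun k _ => D.sum_weight_src K₂ m i k

/-! ### Positivity along paths -/

theorem IsPath.fwd_pos {D : JointDecoding N M S E} {ε : Fin N → E} (hε : D.IsPath ε) (K₂ : ℝ)
    (m : Fin N → Fin M → ℝ) (i : ℕ) (hi : i < N) : 0 < D.fwd K₂ m i (D.src (ε ⟨i, hi⟩)) := by
  induction i with
  | zero => exact zero_lt_one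
  | succ i ih =>
    have h := D.fwd_succ K₂ m ⟨i, by omega⟩ (D.src (ε ⟨i + 1, hi⟩))
    simp only at h
    rw [h]
    refine (mul_pos (ih (by omega)) (D.lam_pos K₂ m ⟨i, by omega⟩ (ε ⟨i, by omega⟩))).trans_le
      (Finset.single_le_sum (f := fun e => D.fwd K₂ m i (D.src e) * D.lam K₂ m ⟨i, by omega⟩ e)
        (fun e _ => mul_nonneg (D.fwd_nonneg _ _ _ _) (D.lam_pos _ _ _ _).le)
        (Finset.mem_filter.2 ⟨hε.1 _, hε.2 i hi⟩))

theorem IsPath.bwd_pos {D : JointDecoding N M S E} {ε : Fin N → E} (hε : D.IsPath ε) (K₂ : ℝ)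
    (m : Fin N → Fin M → ℝ) (i : Fin N) : 0 < D.bwd K₂ m (i + 1) (D.dst (ε i)) := by
  obtain ⟨r, hr⟩ : ∃ r, r + (i + 1) = N := ⟨N - (i + 1), by omega⟩
  induction r generalizing i with
  | zero =>
    rw [show (i : ℕ) + 1 = N by omega, bwd_last]; exact zero_lt_one
  | succ r ih =>
    have hi : (i : ℕ) + 1 < N := by omega
    have h := D.bwd_eq_sum K₂ m ⟨i + 1, hi⟩ (D.dst (ε i))
    simp only at h
    rw [h]
    refine (mul_pos (ih ⟨i + 1, hi⟩ (by simp; omega)) (D.lam_pos K₂ m ⟨i + 1, hi⟩ _)).trans_le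
      (Finset.single_le_sum
        (f := fun e => D.bwd K₂ m (i + 1 + 1) (D.dst e) * D.lam K₂ m ⟨i + 1, hi⟩ e)
        (fun e _ => mul_nonneg (D.bwd_nonneg _ _ _ _) (D.lam_pos _ _ _ _).le)
        (Finset.mem_filter.2 ⟨hε.1 _, (hε.2 i hi).symm⟩))

theorem IsPath.weight_pos {D : JointDecoding N M S E} {ε : Fin N → E} (hε : D.IsPath ε) (K₂ : ℝ)
    (m : Fin N → Fin M → ℝ) (i : Fin N) : 0 < D.weight K₂ m i (ε i) :=
  mul_pos (mul_pos (hε.fwd_pos K₂ m i i.2) (D.lam_pos _ _ _ _)) (hε.bwd_pos K₂ m i)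

/-- A path with constant input `c` contributes a positive term. This keeps all trellis logits
finite. -/
theorem AcceptsAllInputs.sum_inp_pos {D : JointDecoding N M S E} (hD : D.AcceptsAllInputs)
    (K₂ : ℝ) (m : Fin N → Fin M → ℝ) (i : Fin N) (c : Bool) :
    0 < ∑ e ∈ D.sec i with D.inp e = c, D.weight K₂ m i e := by
  obtain ⟨ε, hε, hu⟩ := hD fun _ => c
  exact (hε.weight_pos K₂ m i).trans_le (Finset.single_le_sum (f := D.weight K₂ m i)
    (fun e _ => D.weight_nonneg K₂ m i e) (Finset.mem_filter.2 ⟨hε.1 i, hu i⟩))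

theorem AcceptsAllInputs.partition_pos {D : JointDecoding N M S E} (hD : D.AcceptsAllInputs)
    (hN : 0 < N) (K₂ : ℝ) (m : Fin N → Fin M → ℝ) : 0 < D.partition K₂ m := by
  rw [← D.sum_weight K₂ m ⟨0, hN⟩]
  exact (hD.sum_inp_pos K₂ m ⟨0, hN⟩ true).trans_le (Finset.sum_le_sum_of_subset_of_nonneg
    (Finset.filter_subset _ _) fun e _ _ => D.weight_nonneg _ _ _ _)

/-! ### The normalized messages -/

/-- Normalizing a linear recursion costs one positive factor per time, the same for all states. It
cancels in the beliefs and in the bit messages. -/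
theorem AcceptsAllInputs.alpha_eq {D : JointDecoding N M S E} (hD : D.AcceptsAllInputs)
    (hN : 0 < N) (K₂ : ℝ) (m : Fin N → Fin M → ℝ) (i : ℕ) (hi : i ≤ N) :
    ∃ c : ℝ, 0 < c ∧ ∀ k, D.alpha K₂ m i k = c * D.fwd K₂ m i k := by
  obtain ⟨ε, hε, -⟩ := hD fun _ => true
  induction i with
  | zero =>
    have : Nonempty S := ⟨D.src (ε ⟨0, hN⟩)⟩
    exact ⟨1 / (Fintype.card S : ℝ), by positivity, fun k => by rw [alpha, fwd, mul_one]⟩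
  | succ i ih =>
    obtain ⟨c, hc, hck⟩ := ih (by omega)
    have h1 := fun k => D.alpha_succ K₂ m ⟨i, hi⟩ k
    have h2 := fun k => D.fwd_succ K₂ m ⟨i, hi⟩ k
    simp only [hck, mul_assoc, ← Finset.mul_sum] at h1 h2
    have hpos : 0 < ∑ e ∈ D.sec ⟨i, hi⟩, D.fwd K₂ m i (D.src e) * D.lam K₂ m ⟨i, hi⟩ e :=
      (mul_pos (hε.fwd_pos K₂ m i hi) (D.lam_pos K₂ m ⟨i, hi⟩ _)).trans_le
        (Finset.single_le_sum (f := fun e => D.fwd K₂ m i (D.src e) * D.lam K₂ m ⟨i, hi⟩ e)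
          (fun e _ => mul_nonneg (D.fwd_nonneg _ _ _ _) (D.lam_pos _ _ _ _).le) (hε.1 _))
    refine ⟨_, inv_pos.2 hpos, fun k => ?_⟩
    rw [h1, h2]
    field_simp

theorem AcceptsAllInputs.beta_eq {D : JointDecoding N M S E} (hD : D.AcceptsAllInputs)
    (hN : 0 < N) (K₂ : ℝ) (m : Fin N → Fin M → ℝ) (i : ℕ) (hi : i ≤ N) :
    ∃ c : ℝ, 0 < c ∧ ∀ k, D.beta K₂ m i k = c * D.bwd K₂ m i k := by
  obtain ⟨ε, hε, -⟩ := hD fun _ => true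
  induction hi using Nat.decreasingInduction with
  | self =>
    have : Nonempty S := ⟨D.src (ε ⟨0, hN⟩)⟩
    exact ⟨1 / (Fintype.card S : ℝ), by positivity, fun k => by rw [beta_last, bwd_last, mul_one]⟩
  | @of_succ i hi ih =>
    obtain ⟨c, hc, hck⟩ := ih
    have h1 := fun k => D.beta_eq_div K₂ m ⟨i, hi⟩ k
    have h2 := fun k => D.bwd_eq_sum K₂ m ⟨i, hi⟩ k
    simp only [hck, mul_assoc, ← Finset.mul_sum] at h1 h2
    have hpos : 0 < ∑ e ∈ D.sec ⟨i, hi⟩,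
        D.bwd K₂ m (i + 1) (D.dst e) * D.lam K₂ m ⟨i, hi⟩ e :=
      (mul_pos (hε.bwd_pos K₂ m ⟨i, hi⟩) (D.lam_pos K₂ m ⟨i, hi⟩ _)).trans_le
        (Finset.single_le_sum
          (f := fun e => D.bwd K₂ m (i + 1) (D.dst e) * D.lam K₂ m ⟨i, hi⟩ e)
          (fun e _ => mul_nonneg (D.bwd_nonneg _ _ _ _) (D.lam_pos _ _ _ _).le) (hε.1 _))
    refine ⟨_, inv_pos.2 hpos, fun k => ?_⟩
    rw [h1, h2]
    field_simp

theorem AcceptsAllInputs.edgeWeight_eq {D : JointDecoding N M S E} (hD : D.AcceptsAllInputs)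
    (K₂ : ℝ) (m : Fin N → Fin M → ℝ) (i : Fin N) :
    ∃ c : ℝ, 0 < c ∧ ∀ e, D.edgeWeight K₂ m i e = c * D.weight K₂ m i e := by
  have hN : 0 < N := i.pos
  obtain ⟨a, ha, hae⟩ := hD.alpha_eq hN K₂ m i i.2.le
  obtain ⟨c, hc, hce⟩ := hD.beta_eq hN K₂ m (i + 1) i.2
  refine ⟨a * c, mul_pos ha hc, fun e => ?_⟩
  rw [edgeWeight, weight, hae, hce]; ring

theorem AcceptsAllInputs.gOf_eq {D : JointDecoding N M S E} (hD : D.AcceptsAllInputs)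
    (K₂ : ℝ) (m : Fin N → Fin M → ℝ) (i : Fin N) {e : E} (he : e ∈ D.sec i) :
    D.gOf K₂ m i e = D.weight K₂ m i e / D.partition K₂ m := by
  obtain ⟨c, hc, hce⟩ := hD.edgeWeight_eq K₂ m i
  rw [gOf, if_pos he]
  simp only [hce]
  rw [← Finset.mul_sum, sum_weight, mul_div_mul_left _ _ hc.ne']

theorem AcceptsAllInputs.gam_eq {D : JointDecoding N M S E} (hD : D.AcceptsAllInputs)
    (K₂ : ℝ) (m : Fin N → Fin M → ℝ) (i : Fin N) :
    D.gam K₂ m i = Real.log ((∑ e ∈ D.sec i with D.inp e = false, D.weight K₂ m i e) /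
      ∑ e ∈ D.sec i with D.inp e = true, D.weight K₂ m i e) := by
  obtain ⟨c, hc, hce⟩ := hD.edgeWeight_eq K₂ m i
  rw [gam]
  simp only [hce]
  rw [← Finset.mul_sum, ← Finset.mul_sum, mul_div_mul_left _ _ hc.ne']

/-! ### Trellis flows and the variational formula for the partition function -/

/-- Unit flows through the trellis. -/
structure IsFlow (D : JointDecoding N M S E) (g : Fin N → E → ℝ) : Prop where
  g_sum : ∀ p, ∑ e ∈ D.sec p, g p e = 1
  flow : ∀ (i : ℕ) (h : i + 1 < N) (k : S),
    ∑ e ∈ D.sec ⟨i, Nat.lt_of_succ_lt h⟩ with D.dst e = k, g ⟨i, Nat.lt_of_succ_lt h⟩ e =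
      ∑ e ∈ D.sec ⟨i + 1, h⟩ with D.src e = k, g ⟨i + 1, h⟩ e
  g_nonneg : ∀ i, ∀ e ∈ D.sec i, 0 ≤ g i e

theorem Feasible.isFlow {D : JointDecoding N M S E}
    {x : (Fin N → E → ℝ) × (Fin M → Finset (Fin N) → ℝ)} (hx : D.Feasible x) : D.IsFlow x.1 :=
  ⟨hx.g_sum, hx.flow, hx.g_nonneg⟩

/-- The state distribution of a flow at time `i`. -/
def stateFlow (D : JointDecoding N M S E) (g : Fin N → E → ℝ) : ℕ → S → ℝ
  | 0, k => if h : 0 < N then ∑ e ∈ D.sec ⟨0, h⟩ with D.src e = k, g ⟨0, h⟩ e else 0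
  | i + 1, k => if h : i < N then ∑ e ∈ D.sec ⟨i, h⟩ with D.dst e = k, g ⟨i, h⟩ e else 0

theorem stateFlow_succ (D : JointDecoding N M S E) (g : Fin N → E → ℝ) (i : Fin N) (k : S) :
    D.stateFlow g (i + 1) k = ∑ e ∈ D.sec i with D.dst e = k, g i e := by
  rw [stateFlow, dif_pos i.2]

theorem IsFlow.sum_src {D : JointDecoding N M S E} {g : Fin N → E → ℝ} (hg : D.IsFlow g)
    (i : Fin N) (k : S) : ∑ e ∈ D.sec i with D.src e = k, g i e = D.stateFlow g i k := by
  obtain ⟨i, hi⟩ := i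
  cases i with
  | zero => simp only; rw [stateFlow, dif_pos hi]
  | succ i => rw [← hg.flow i hi k, ← D.stateFlow_succ g ⟨i, by omega⟩ k]

/-- A state with backward value zero has no continuation to the end, and conservation propagates the
absence of flow backwards. This supplies the support condition of the log-sum inequality. -/
theorem IsFlow.eq_zero_of_bwd_eq_zero {D : JointDecoding N M S E} {g : Fin N → E → ℝ}
    (hg : D.IsFlow g) (K₂ : ℝ) (m : Fin N → Fin M → ℝ) (i : Fin N) {e : E} (he : e ∈ D.sec i)
    (h : D.bwd K₂ m (i + 1) (D.dst e) = 0) : g i e = 0 := by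
  obtain ⟨r, hr⟩ : ∃ r, r + (i + 1) = N := ⟨N - (i + 1), by omega⟩
  induction r generalizing i e with
  | zero =>
    rw [show (i : ℕ) + 1 = N by omega, bwd_last] at h
    exact absurd h one_ne_zero
  | succ r ih =>
    have hi : (i : ℕ) + 1 < N := by omega
    have hb := D.bwd_eq_sum K₂ m ⟨i + 1, hi⟩ (D.dst e)
    simp only at hb
    rw [hb, Finset.sum_eq_zero_iff_of_nonneg
      fun e _ => mul_nonneg (D.bwd_nonneg _ _ _ _) (D.lam_pos _ _ _ _).le] at h
    have hz : ∑ e' ∈ D.sec ⟨i + 1, hi⟩ with D.src e' = D.dst e, g ⟨i + 1, hi⟩ e' = 0 :=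
      Finset.sum_eq_zero fun e' he' => ih ⟨i + 1, hi⟩ (Finset.mem_filter.1 he').1
        ((mul_eq_zero.1 (h e' he')).resolve_right (D.lam_pos _ _ _ _).ne') (by simp; omega)
    rw [← hg.flow i hi] at hz
    exact (Finset.sum_eq_zero_iff_of_nonneg fun e' he' =>
      hg.g_nonneg _ _ (Finset.mem_filter.1 he').1).1 hz e (Finset.mem_filter.2 ⟨he, rfl⟩)

/-- The potential of the state distribution at time `i` in the variational formula. -/
noncomputable def statePotential (D : JointDecoding N M S E) (K₂ : ℝ) (m : Fin N → Fin M → ℝ)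
    (g : Fin N → E → ℝ) (i : ℕ) : ℝ :=
  ∑ k : S, (Real.negMulLog (D.stateFlow g i k) + D.stateFlow g i k * Real.log (D.bwd K₂ m i k))

/-- Chain-rule step of the variational formula, with its case of equality. -/
theorem IsFlow.section_step {D : JointDecoding N M S E} {g : Fin N → E → ℝ} (hg : D.IsFlow g)
    (K₂ : ℝ) (m : Fin N → Fin M → ℝ) (i : Fin N) :
    (D.sectionEntropy g i + ∑ e ∈ D.sec i, g i e * Real.log (D.lam K₂ m i e)) +
        D.statePotential K₂ m g (i + 1) - D.stateEntropy g i ≤ D.statePotential K₂ m g i ∧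
      ((D.sectionEntropy g i + ∑ e ∈ D.sec i, g i e * Real.log (D.lam K₂ m i e)) +
          D.statePotential K₂ m g (i + 1) - D.stateEntropy g i = D.statePotential K₂ m g i ↔
        ∀ e ∈ D.sec i, g i e * D.bwd K₂ m i (D.src e) =
          D.stateFlow g i (D.src e) * (D.bwd K₂ m (i + 1) (D.dst e) * D.lam K₂ m i e)) := by
  set c : E → ℝ := fun e => D.bwd K₂ m (i + 1) (D.dst e) * D.lam K₂ m i e with hcdef
  have hsupp : ∀ e ∈ D.sec i, c e = 0 → g i e = 0 := fun e he h =>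
    hg.eq_zero_of_bwd_eq_zero K₂ m i he
      ((mul_eq_zero.1 h).resolve_right (D.lam_pos _ _ _ _).ne')
  have hlhs : (D.sectionEntropy g i + ∑ e ∈ D.sec i, g i e * Real.log (D.lam K₂ m i e)) +
      D.statePotential K₂ m g (i + 1) - D.stateEntropy g i =
      ∑ k : S, ∑ e ∈ D.sec i with D.src e = k,
        (Real.negMulLog (g i e) + g i e * Real.log (c e)) := by
    -- The state entropy cancels the entropy part of the potential at time `i + 1`; the logarithmic
    -- part is redistributed over the edges by final state.
    have h1 : D.statePotential K₂ m g (i + 1) - D.stateEntropy g i =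
        ∑ e ∈ D.sec i, g i e * Real.log (D.bwd K₂ m (i + 1) (D.dst e)) := by
      rw [statePotential, stateEntropy, ← Finset.sum_sub_distrib,
        ← Finset.sum_fiberwise (D.sec i) D.dst]
      refine Finset.sum_congr rfl fun k _ => ?_
      rw [D.stateFlow_succ, add_sub_cancel_left, Finset.sum_mul]
      exact Finset.sum_congr rfl fun e he => by rw [(Finset.mem_filter.1 he).2]
    rw [add_sub_assoc, h1, Finset.sum_fiberwise, sectionEntropy, ← Finset.sum_add_distrib,
      ← Finset.sum_add_distrib]
    refine Finset.sum_congr rfl fun e he => ?_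
    by_cases hb : D.bwd K₂ m (i + 1) (D.dst e) = 0
    · simp [hg.eq_zero_of_bwd_eq_zero K₂ m i he hb]
    · rw [hcdef]
      simp only
      rw [Real.log_mul hb (D.lam_pos _ _ _ _).ne']; ring
  -- The log-sum inequality among the edges leaving `k`, where `c` has total `D.bwd K₂ m i k`.
  have hk := fun k : S => sum_negMulLog_add_mul_log_le ((D.sec i).filter fun e => D.src e = k)
    (g i) c (fun e he => hg.g_nonneg i e (Finset.mem_filter.1 he).1)
    (fun e _ => mul_nonneg (D.bwd_nonneg _ _ _ _) (D.lam_pos _ _ _ _).le)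
    (fun e he => hsupp e (Finset.mem_filter.1 he).1)
  simp only [hcdef, ← D.bwd_eq_sum, hg.sum_src] at hk
  rw [hlhs, statePotential]
  refine ⟨Finset.sum_le_sum fun k _ => (hk k).1, ?_⟩
  rw [Finset.sum_eq_sum_iff_of_le fun k _ => (hk k).1]
  simp only [Finset.mem_univ, forall_const]
  constructor
  · intro h e he
    exact (hk (D.src e)).2.1 (h _) e (Finset.mem_filter.2 ⟨he, rfl⟩)
  · intro h k
    refine (hk k).2.2 fun e he => ?_
    obtain ⟨hmem, rfl⟩ := Finset.mem_filter.1 he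
    exact h e hmem

theorem IsFlow.sum_stateFlow_zero {D : JointDecoding N M S E} {g : Fin N → E → ℝ}
    (hg : D.IsFlow g) (hN : 0 < N) : ∑ k : S, D.stateFlow g 0 k = 1 := by
  have h := fun k => hg.sum_src ⟨0, hN⟩ k
  simp only at h
  simp only [← h, Finset.sum_fiberwise, hg.g_sum]

/-- The log-sum inequality over the initial states, whose flow has total mass one. -/
theorem IsFlow.initial_step {D : JointDecoding N M S E} {g : Fin N → E → ℝ} (hg : D.IsFlow g)
    (hN : 0 < N) (K₂ : ℝ) (m : Fin N → Fin M → ℝ) :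
    D.statePotential K₂ m g 0 ≤ Real.log (D.partition K₂ m) ∧
      (D.statePotential K₂ m g 0 = Real.log (D.partition K₂ m) ↔
        ∀ k, D.stateFlow g 0 k * D.partition K₂ m = D.bwd K₂ m 0 k) := by
  have hsrc := fun k => hg.sum_src ⟨0, hN⟩ k
  have hb := fun k => D.bwd_eq_sum K₂ m ⟨0, hN⟩ k
  simp only at hsrc hb
  have h := sum_negMulLog_add_mul_log_le Finset.univ (D.stateFlow g 0) (D.bwd K₂ m 0)
    (fun k _ => by
      rw [← hsrc]
      exact Finset.sum_nonneg fun e he => hg.g_nonneg _ _ (Finset.mem_filter.1 he).1)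
    (fun k _ => D.bwd_nonneg _ _ _ _) (fun k _ hk => by
      rw [hb, Finset.sum_eq_zero_iff_of_nonneg
        fun e _ => mul_nonneg (D.bwd_nonneg _ _ _ _) (D.lam_pos _ _ _ _).le] at hk
      rw [← hsrc]
      exact Finset.sum_eq_zero fun e he =>
        hg.eq_zero_of_bwd_eq_zero K₂ m ⟨0, hN⟩ (Finset.mem_filter.1 he).1
          ((mul_eq_zero.1 (hk e he)).resolve_right (D.lam_pos _ _ _ _).ne'))
  simpa [hg.sum_stateFlow_zero hN, statePotential, partition] using h

/-- Treats all sections alike by subtracting the last state entropy too. The compensating term is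
the potential at time `N`, where the backward variable is one. -/
theorem trellisEntropy_eq_sum_sub (D : JointDecoding N M S E) (hN : 0 < N) (g : Fin N → E → ℝ) :
    D.trellisEntropy g = ∑ i, (D.sectionEntropy g i - D.stateEntropy g i) +
      D.stateEntropy g ⟨N - 1, by omega⟩ := by
  have h : (Finset.univ.filter fun i : Fin N => ¬ (i : ℕ) + 1 < N) = {⟨N - 1, by omega⟩} := by
    ext i; simp [Fin.ext_iff]; omega
  rw [trellisEntropy, Finset.sum_sub_distrib,
    ← Finset.sum_filter_add_sum_filter_not Finset.univ (fun i : Fin N => (i : ℕ) + 1 < N)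
      (D.stateEntropy g), h, Finset.sum_singleton]
  ring

/-- The variational formula for the partition function: the bound. -/
theorem IsFlow.trellisEntropy_add_le {D : JointDecoding N M S E} {g : Fin N → E → ℝ}
    (hg : D.IsFlow g) (hN : 0 < N) (K₂ : ℝ) (m : Fin N → Fin M → ℝ) :
    D.trellisEntropy g + ∑ i, ∑ e ∈ D.sec i, g i e * Real.log (D.lam K₂ m i e) ≤
        Real.log (D.partition K₂ m) ∧
      (D.trellisEntropy g + ∑ i, ∑ e ∈ D.sec i, g i e * Real.log (D.lam K₂ m i e) =
          Real.log (D.partition K₂ m) ↔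
        (∀ k, D.stateFlow g 0 k * D.partition K₂ m = D.bwd K₂ m 0 k) ∧
        ∀ i, ∀ e ∈ D.sec i, g i e * D.bwd K₂ m i (D.src e) =
          D.stateFlow g i (D.src e) * (D.bwd K₂ m (i + 1) (D.dst e) * D.lam K₂ m i e)) := by
  have hlast : D.statePotential K₂ m g N = D.stateEntropy g ⟨N - 1, by omega⟩ := by
    have h := fun k => D.stateFlow_succ g ⟨N - 1, by omega⟩ k
    simp only [Nat.sub_add_cancel hN] at h
    simp [statePotential, stateEntropy, bwd_last, h]
  have htel : ∑ i : Fin N, (D.statePotential K₂ m g (i + 1) - D.statePotential K₂ m g i) =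
      D.statePotential K₂ m g N - D.statePotential K₂ m g 0 := by
    rw [Fin.sum_univ_eq_sum_range
      (fun i => D.statePotential K₂ m g (i + 1) - D.statePotential K₂ m g i), Finset.sum_range_sub]
  -- Telescoping the potentials leaves the initial potential plus nonpositive section defects, so
  -- equality forces each of them to vanish.
  have hrew : D.trellisEntropy g + ∑ i, ∑ e ∈ D.sec i, g i e * Real.log (D.lam K₂ m i e) =
      D.statePotential K₂ m g 0 + ∑ i : Fin N,
        ((D.sectionEntropy g i + ∑ e ∈ D.sec i, g i e * Real.log (D.lam K₂ m i e)) +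
        D.statePotential K₂ m g (i + 1) - D.stateEntropy g i - D.statePotential K₂ m g i) := by
    rw [D.trellisEntropy_eq_sum_sub hN, ← hlast]
    simp only [Finset.sum_sub_distrib, Finset.sum_add_distrib] at htel ⊢
    linarith
  have h0 := hg.initial_step hN K₂ m
  have hs := hg.section_step K₂ m
  have hle : ∀ i ∈ (Finset.univ : Finset (Fin N)),
      (D.sectionEntropy g i + ∑ e ∈ D.sec i, g i e * Real.log (D.lam K₂ m i e)) +
        D.statePotential K₂ m g (i + 1) - D.stateEntropy g i - D.statePotential K₂ m g i ≤ 0 :=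
    fun i _ => sub_nonpos.2 (hs i).1
  have hsum := Finset.sum_nonpos hle
  rw [hrew]
  refine ⟨by linarith [h0.1], fun h => ?_, fun h => ?_⟩
  · have h1 : D.statePotential K₂ m g 0 = Real.log (D.partition K₂ m) :=
      le_antisymm h0.1 (by linarith)
    refine ⟨h0.2.1 h1, fun i => (hs i).2.1 ?_⟩
    exact sub_eq_zero.1 ((Finset.sum_eq_zero_iff_of_nonpos hle).1 (by linarith) i (Finset.mem_univ i))
  · rw [h0.2.2 h.1, Finset.sum_eq_zero fun i _ => sub_eq_zero.2 ((hs i).2.2 (h.2 i)), add_zero]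

/-- The only flow that attains the bound is the normalized belief. -/
theorem IsFlow.eq_gOf {D : JointDecoding N M S E} (hD : D.AcceptsAllInputs)
    {g : Fin N → E → ℝ} (hg : D.IsFlow g) (hN : 0 < N) {K₂ : ℝ} {m : Fin N → Fin M → ℝ}
    (h : D.trellisEntropy g + ∑ i, ∑ e ∈ D.sec i, g i e * Real.log (D.lam K₂ m i e) =
      Real.log (D.partition K₂ m)) (i : Fin N) {e : E} (he : e ∈ D.sec i) :
    g i e = D.gOf K₂ m i e := by
  obtain ⟨h0, hs⟩ := (hg.trellisEntropy_add_le hN K₂ m).2.1 h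
  have hZ := hD.partition_pos hN K₂ m
  have hedge : ∀ i : Fin N,
      (∀ k, D.stateFlow g i k * D.partition K₂ m = D.fwd K₂ m i k * D.bwd K₂ m i k) →
      ∀ e ∈ D.sec i, g i e * D.partition K₂ m = D.weight K₂ m i e := by
    intro i hi e he
    -- The equality condition determines `g i e` only after division by the backward value; where
    -- that is zero, flow and weight both vanish.
    by_cases hb : D.bwd K₂ m i (D.src e) = 0
    · have hb' := hb
      rw [D.bwd_eq_sum, Finset.sum_eq_zero_iff_of_nonneg
        fun e _ => mul_nonneg (D.bwd_nonneg _ _ _ _) (D.lam_pos _ _ _ _).le] at hb'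
      have hz := (mul_eq_zero.1 (hb' e (Finset.mem_filter.2 ⟨he, rfl⟩))).resolve_right
        (D.lam_pos _ _ _ _).ne'
      rw [hg.eq_zero_of_bwd_eq_zero K₂ m i he hz, weight, hz]; simp
    · apply mul_right_cancel₀ hb
      rw [mul_right_comm, hs i e he, mul_right_comm, hi, weight]; ring
  have hstate : ∀ i, i ≤ N → ∀ k,
      D.stateFlow g i k * D.partition K₂ m = D.fwd K₂ m i k * D.bwd K₂ m i k := by
    intro i
    induction i with
    | zero => intro _ k; rw [h0, fwd, one_mul]
    | succ i ih =>
      intro hi k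
      have h1 := D.stateFlow_succ g ⟨i, hi⟩ k
      have h2 := D.sum_weight_dst K₂ m ⟨i, hi⟩ k
      simp only at h1 h2
      rw [h1, ← h2, Finset.sum_mul]
      exact Finset.sum_congr rfl fun e he =>
        hedge ⟨i, hi⟩ (ih (by omega)) e (Finset.mem_filter.1 he).1
  rw [hD.gOf_eq K₂ m i he, eq_div_iff hZ.ne']
  exact hedge i (hstate i i.2.le) e he

/-- Conservation holds since the edges entering a state and those leaving it have the same total
weight, forward times backward value, and all sections share one partition function. -/
theorem AcceptsAllInputs.isFlow_gOf {D : JointDecoding N M S E} (hD : D.AcceptsAllInputs)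
    (K₂ : ℝ) (m : Fin N → Fin M → ℝ) : D.IsFlow (D.gOf K₂ m) where
  g_sum p := by
    rw [Finset.sum_congr rfl fun e he => hD.gOf_eq K₂ m p he, ← Finset.sum_div, sum_weight,
      div_self (hD.partition_pos p.pos K₂ m).ne']
  flow i h k := by
    rw [Finset.sum_congr rfl fun e he => hD.gOf_eq K₂ m _ (Finset.mem_filter.1 he).1,
      Finset.sum_congr rfl fun e he => hD.gOf_eq K₂ m _ (Finset.mem_filter.1 he).1,
      ← Finset.sum_div, ← Finset.sum_div, sum_weight_dst, sum_weight_src]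
  g_nonneg i e he := by
    rw [hD.gOf_eq K₂ m i he]
    exact div_nonneg (D.weight_nonneg _ _ _ _) (hD.partition_pos i.pos K₂ m).le

theorem AcceptsAllInputs.stateFlow_gOf {D : JointDecoding N M S E} (hD : D.AcceptsAllInputs)
    (K₂ : ℝ) (m : Fin N → Fin M → ℝ) (i : Fin N) (k : S) :
    D.stateFlow (D.gOf K₂ m) i k = D.fwd K₂ m i k * D.bwd K₂ m i k / D.partition K₂ m := by
  rw [← (hD.isFlow_gOf K₂ m).sum_src,
    Finset.sum_congr rfl fun e he => hD.gOf_eq K₂ m _ (Finset.mem_filter.1 he).1,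
    ← Finset.sum_div, sum_weight_src]

/-- The normalized belief attains the bound. -/
theorem AcceptsAllInputs.trellisEntropy_gOf {D : JointDecoding N M S E} (hD : D.AcceptsAllInputs)
    (hN : 0 < N) (K₂ : ℝ) (m : Fin N → Fin M → ℝ) :
    D.trellisEntropy (D.gOf K₂ m) +
      ∑ i, ∑ e ∈ D.sec i, D.gOf K₂ m i e * Real.log (D.lam K₂ m i e) =
        Real.log (D.partition K₂ m) := by
  have hZ := hD.partition_pos hN K₂ m
  refine (((hD.isFlow_gOf K₂ m).trellisEntropy_add_le hN K₂ m).2).2 ⟨fun k => ?_, fun i e he => ?_⟩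
  · have h := hD.stateFlow_gOf K₂ m ⟨0, hN⟩ k
    simp only at h
    rw [h, fwd]; field_simp
  · rw [hD.gOf_eq K₂ m i he, hD.stateFlow_gOf, weight]; ring

/-! ### Local beliefs of the checks -/

theorem mem_bitNbr {D : JointDecoding N M S E} {i : Fin N} {j : Fin M} :
    j ∈ D.bitNbr i ↔ i ∈ D.checkNbr j := by
  simp [bitNbr, checkNbr]

theorem mem_patterns {D : JointDecoding N M S E} {j : Fin M} {B : Finset (Fin N)} :
    B ∈ D.patterns j ↔ B ⊆ D.checkNbr j ∧ Even B.card := by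
  simp [patterns]

theorem empty_mem_patterns (D : JointDecoding N M S E) (j : Fin M) : ∅ ∈ D.patterns j := by
  simp [mem_patterns]

theorem mem_bitNbr_of_mem_pattern {D : JointDecoding N M S E} {i : Fin N} {j : Fin M}
    {B : Finset (Fin N)} (hB : B ∈ D.patterns j) (hi : i ∈ B) : j ∈ D.bitNbr i :=
  mem_bitNbr.2 ((mem_patterns.1 hB).1 hi)

/-- The unnormalized belief of a pattern. -/
noncomputable def patWeight (K₁ : ℝ) (m : Fin N → Fin M → ℝ) (j : Fin M) (B : Finset (Fin N)) : ℝ :=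
  Real.exp (-K₁ * ∑ i ∈ B, m i j)

theorem patWeight_pos (K₁ : ℝ) (m : Fin N → Fin M → ℝ) (j : Fin M) (B : Finset (Fin N)) :
    0 < patWeight K₁ m j B := Real.exp_pos _

/-- The partition function of a check. -/
noncomputable def checkPartition (D : JointDecoding N M S E) (K₁ : ℝ) (m : Fin N → Fin M → ℝ)
    (j : Fin M) : ℝ :=
  ∑ B ∈ D.patterns j, patWeight K₁ m j B

/-- The total weight of the patterns that contain bit `i`. -/
noncomputable def checkIn (D : JointDecoding N M S E) (K₁ : ℝ) (m : Fin N → Fin M → ℝ)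
    (i : Fin N) (j : Fin M) : ℝ :=
  ∑ B ∈ D.patterns j with i ∈ B, patWeight K₁ m j B

/-- The total weight of the patterns that do not contain bit `i`. -/
noncomputable def checkOut (D : JointDecoding N M S E) (K₁ : ℝ) (m : Fin N → Fin M → ℝ)
    (i : Fin N) (j : Fin M) : ℝ :=
  ∑ B ∈ D.patterns j with i ∉ B, patWeight K₁ m j B

theorem checkOut_add_checkIn (D : JointDecoding N M S E) (K₁ : ℝ) (m : Fin N → Fin M → ℝ)
    (i : Fin N) (j : Fin M) :
    D.checkOut K₁ m i j + D.checkIn K₁ m i j = D.checkPartition K₁ m j := by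
  rw [add_comm, checkOut, checkIn, Finset.sum_filter_add_sum_filter_not, checkPartition]

theorem checkPartition_pos (D : JointDecoding N M S E) (K₁ : ℝ) (m : Fin N → Fin M → ℝ)
    (j : Fin M) : 0 < D.checkPartition K₁ m j :=
  Finset.sum_pos (fun B _ => patWeight_pos K₁ m j B) ⟨∅, D.empty_mem_patterns j⟩

theorem checkOut_pos (D : JointDecoding N M S E) (K₁ : ℝ) (m : Fin N → Fin M → ℝ)
    (i : Fin N) (j : Fin M) : 0 < D.checkOut K₁ m i j :=
  Finset.sum_pos (fun B _ => patWeight_pos K₁ m j B)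
    ⟨∅, Finset.mem_filter.2 ⟨D.empty_mem_patterns j, by simp⟩⟩

theorem pair_mem_patterns {D : JointDecoding N M S E} {i r : Fin N} {j : Fin M}
    (hi : i ∈ D.checkNbr j) (hr : r ∈ D.checkNbr j) (h : i ≠ r) : {i, r} ∈ D.patterns j := by
  rw [mem_patterns, Finset.card_pair h]
  exact ⟨by simp [Finset.insert_subset_iff, hi, hr], even_two⟩

/-- A second neighbour `r` gives the even pattern `{i, r}`. A check of weight one would force its
bit to zero and make its logit infinite. -/
theorem checkIn_pos {D : JointDecoding N M S E} (hcheck : ∀ j, (D.checkNbr j).card ≠ 1) (K₁ : ℝ)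
    (m : Fin N → Fin M → ℝ) {i : Fin N} {j : Fin M} (hij : j ∈ D.bitNbr i) :
    0 < D.checkIn K₁ m i j := by
  have hi := mem_bitNbr.1 hij
  have hcard : 1 < (D.checkNbr j).card := by
    have := Finset.card_pos.2 ⟨i, hi⟩
    have := hcheck j
    omega
  obtain ⟨r, hr, hne⟩ := Finset.exists_mem_ne hcard i
  exact Finset.sum_pos (fun B _ => patWeight_pos K₁ m j B)
    ⟨{i, r}, Finset.mem_filter.2 ⟨pair_mem_patterns hi hr hne.symm, by simp⟩⟩

theorem wOf_eq (D : JointDecoding N M S E) (K₁ : ℝ) (m : Fin N → Fin M → ℝ) (j : Fin M)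
    {B : Finset (Fin N)} (hB : B ∈ D.patterns j) :
    D.wOf K₁ m j B = patWeight K₁ m j B / D.checkPartition K₁ m j := by
  rw [wOf, if_pos hB]; rfl

theorem patWeight_eq_prod (K₁ : ℝ) (m : Fin N → Fin M → ℝ) (j : Fin M) (B : Finset (Fin N)) :
    patWeight K₁ m j B = ∏ i ∈ B, Real.exp (-K₁ * m i j) := by
  rw [patWeight, Finset.mul_sum, Real.exp_sum]

theorem checkOut_eq (D : JointDecoding N M S E) (K₁ : ℝ) (m : Fin N → Fin M → ℝ) (i : Fin N)
    (j : Fin M) :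
    D.checkOut K₁ m i j = ∑ B ∈ ((D.checkNbr j).erase i).powerset with Even B.card,
      ∏ r ∈ B, Real.exp (-K₁ * m r j) := by
  simp only [checkOut, patWeight_eq_prod]
  refine Finset.sum_congr ?_ fun _ _ => rfl
  ext B
  simp only [Finset.mem_filter, mem_patterns, Finset.mem_powerset, Finset.subset_erase]
  tauto

/-- Deleting `i` is a bijection from the even patterns through `i` to the odd subsets of the other
bits. -/
theorem checkIn_eq (D : JointDecoding N M S E) (K₁ : ℝ) (m : Fin N → Fin M → ℝ) {i : Fin N}
    {j : Fin M} (hij : j ∈ D.bitNbr i) :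
    D.checkIn K₁ m i j = Real.exp (-K₁ * m i j) *
      ∑ B ∈ ((D.checkNbr j).erase i).powerset with ¬ Even B.card,
        ∏ r ∈ B, Real.exp (-K₁ * m r j) := by
  have hi := mem_bitNbr.1 hij
  simp only [checkIn, patWeight_eq_prod, Finset.mul_sum]
  refine Finset.sum_nbij' (fun B => B.erase i) (fun B => insert i B) ?_ ?_ ?_ ?_ ?_
  · intro B hB
    simp only [Finset.mem_filter, mem_patterns, Finset.mem_powerset] at hB ⊢
    refine ⟨Finset.erase_subset_erase i hB.1.1, ?_⟩
    have := Finset.card_erase_add_one hB.2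
    rw [← this, Nat.even_add_one] at hB
    exact hB.1.2
  · intro B hB
    simp only [Finset.mem_filter, mem_patterns, Finset.mem_powerset, Finset.subset_erase] at hB ⊢
    refine ⟨⟨Finset.insert_subset hi hB.1.1, ?_⟩, Finset.mem_insert_self i B⟩
    rw [Finset.card_insert_of_notMem hB.1.2, Nat.even_add_one]
    exact hB.2
  · intro B hB
    exact Finset.insert_erase (Finset.mem_filter.1 hB).2
  · intro B hB
    simp only [Finset.mem_filter, Finset.mem_powerset, Finset.subset_erase] at hB
    exact Finset.erase_insert hB.1.2
  · intro B hB
    exact (Finset.mul_prod_erase B (fun r => Real.exp (-K₁ * m r j))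
      (Finset.mem_filter.1 hB).2).symm

/-- The logit of bit `i` in the local belief of check `j`. -/
noncomputable def checkLogit (D : JointDecoding N M S E) (K₁ : ℝ) (m : Fin N → Fin M → ℝ)
    (i : Fin N) (j : Fin M) : ℝ :=
  Real.log (D.checkOut K₁ m i j / D.checkIn K₁ m i j)

theorem tanh_half_eq (x : ℝ) : Real.tanh (x / 2) = (1 - Real.exp (-x)) / (1 + Real.exp (-x)) := by
  have h : Real.exp (-x) = Real.exp (-(x / 2)) * Real.exp (-(x / 2)) := by
    rw [← Real.exp_add]; ring_nf
  rw [Real.tanh_eq_sinh_div_cosh, Real.sinh_eq, Real.cosh_eq, h, Real.exp_neg (x / 2)]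
  have := Real.exp_pos (x / 2)
  field_simp

/-- The tanh rule: the product of hyperbolic tangents is `(even - odd) / (even + odd)` for the
pattern sums over the other bits. The message is thus `log (odd / even) / K₁`, while the logit is
`K₁ * m i j + log (even / odd)`. -/
theorem checkMsg_eq {D : JointDecoding N M S E} (hcheck : ∀ j, (D.checkNbr j).card ≠ 1)
    {K₁ : ℝ} (hK₁ : 0 < K₁) (m : Fin N → Fin M → ℝ) {i : Fin N} {j : Fin M}
    (hij : j ∈ D.bitNbr i) :
    D.checkMsg K₁ m i j = m i j - D.checkLogit K₁ m i j / K₁ := by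
  have hout := D.checkOut_pos K₁ m i j
  have hin := checkIn_pos hcheck K₁ m hij
  have hin' := D.checkIn_eq K₁ m hij
  have hadd := sum_even_add_sum_odd ((D.checkNbr j).erase i) fun r => Real.exp (-K₁ * m r j)
  have hsub := sum_even_sub_sum_odd ((D.checkNbr j).erase i) fun r => Real.exp (-K₁ * m r j)
  rw [← checkOut_eq] at hadd hsub
  set odd := ∑ B ∈ ((D.checkNbr j).erase i).powerset with ¬ Even B.card,
        ∏ r ∈ B, Real.exp (-K₁ * m r j)
  have hodd : 0 < odd := by
    rw [hin'] at hin
    exact pos_of_mul_pos_right hin (Real.exp_pos _).le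
  have hell : D.ell K₁ m i j =
      (D.checkOut K₁ m i j - odd) / (D.checkOut K₁ m i j + odd) := by
    rw [hadd, hsub, ← Finset.prod_div_distrib, ell]
    refine Finset.prod_congr rfl fun r _ => ?_
    rw [tanh_half_eq, neg_mul]
  have hratio : (1 - D.ell K₁ m i j) / (1 + D.ell K₁ m i j) = odd / D.checkOut K₁ m i j := by
    have h1 : 1 - D.ell K₁ m i j = 2 * odd / (D.checkOut K₁ m i j + odd) := by
      rw [hell]; field_simp; ring
    have h2 : 1 + D.ell K₁ m i j = 2 * D.checkOut K₁ m i j / (D.checkOut K₁ m i j + odd) := by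
      rw [hell]; field_simp; ring
    rw [h1, h2]; field_simp
  rw [checkMsg, hratio, checkLogit, hin', Real.log_div hodd.ne' hout.ne',
    Real.log_div hout.ne' (by positivity), Real.log_mul (Real.exp_pos _).ne' hodd.ne',
    Real.log_exp]
  field_simp
  ring

/-! ### The dual function -/

/-- The total belief weight of the edges of section `i` with input `c`. -/
noncomputable def bitMass (D : JointDecoding N M S E) (K₂ : ℝ) (m : Fin N → Fin M → ℝ)
    (i : Fin N) (c : Bool) : ℝ :=
  ∑ e ∈ D.sec i with D.inp e = c, D.weight K₂ m i e

theorem bitMass_add (D : JointDecoding N M S E) (K₂ : ℝ) (m : Fin N → Fin M → ℝ) (i : Fin N) :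
    D.bitMass K₂ m i false + D.bitMass K₂ m i true = D.partition K₂ m := by
  rw [← D.sum_weight K₂ m i, ← Finset.sum_fiberwise (D.sec i) D.inp, Fintype.sum_bool, add_comm]
  rfl

/-- The logit of bit `i` in the trellis belief. -/
noncomputable def bitLogit (D : JointDecoding N M S E) (K₂ : ℝ) (m : Fin N → Fin M → ℝ)
    (i : Fin N) : ℝ :=
  Real.log (D.bitMass K₂ m i false / D.bitMass K₂ m i true)

/-- The objective of Problem-DS in terms of the partition functions. -/
noncomputable def dual (D : JointDecoding N M S E) (K₁ K₂ : ℝ) (m : Fin N → Fin M → ℝ) : ℝ :=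
  -(1 / K₁) * ∑ j, Real.log (D.checkPartition K₁ m j) - 1 / K₂ * Real.log (D.partition K₂ m)

/-- The edge weights of every section add up to the same partition function, so the choice of `p` is
immaterial. -/
theorem dsObj_eq_dual (D : JointDecoding N M S E) (K₁ K₂ : ℝ) (p : Fin N) (m : Fin N → Fin M → ℝ) :
    D.dsObj K₁ K₂ p m = D.dual K₁ K₂ m := by
  have h1 : ∀ j, ∀ B ∈ D.patterns j,
      Real.exp (-K₁ * ∑ i ∈ D.checkNbr j, if i ∈ B then m i j else 0) = patWeight K₁ m j B := by
    intro j B hB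
    rw [patWeight, ← Finset.sum_filter, Finset.filter_mem_eq_inter,
      Finset.inter_eq_right.2 (mem_patterns.1 hB).1]
  have h2 : ∑ e ∈ D.sec p, D.fwd K₂ m p (D.src e) * D.lam K₂ m p e * D.bwd K₂ m (p + 1) (D.dst e) =
      D.partition K₂ m := D.sum_weight K₂ m p
  rw [dsObj, dual, h2]
  congr 2
  exact Finset.sum_congr rfl fun j _ => by rw [Finset.sum_congr rfl (h1 j), checkPartition]

/-- The bit marginal of a vector of edge variables. -/
def marg (D : JointDecoding N M S E) (g : Fin N → E → ℝ) (i : Fin N) : ℝ :=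
  ∑ e ∈ D.sec i with D.inp e = true, g i e

/-- Exchanging the sums makes the pattern averages depend on the bit marginals only. This cancels
the multiplier terms in weak duality, and with uniform `w` it serves in the coercivity estimate. -/
theorem sum_pattern_messages {D : JointDecoding N M S E} {w : Fin M → Finset (Fin N) → ℝ}
    {q : Fin N → ℝ}
    (h : ∀ i, ∀ j ∈ D.bitNbr i, ∑ B ∈ D.patterns j with i ∈ B, w j B = q i)
    (m : Fin N → Fin M → ℝ) :
    ∑ j, ∑ B ∈ D.patterns j, w j B * ∑ i ∈ B, m i j =
      ∑ i, (∑ j ∈ D.bitNbr i, m i j) * q i := by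
  have h1 : ∀ j, ∑ B ∈ D.patterns j, w j B * ∑ i ∈ B, m i j =
      ∑ i, m i j * ∑ B ∈ D.patterns j with i ∈ B, w j B := by
    intro j
    simp only [Finset.mul_sum, Finset.sum_filter]
    rw [Finset.sum_comm]
    refine Finset.sum_congr rfl fun B _ => ?_
    simp only [mul_ite, mul_zero, ← Finset.sum_filter, Finset.filter_univ_mem]
    exact Finset.sum_congr rfl fun i _ => mul_comm _ _
  rw [Finset.sum_congr rfl fun j _ => h1 j, Finset.sum_comm]
  refine Finset.sum_congr rfl fun i _ => ?_
  rw [Finset.sum_mul, ← Finset.sum_subset (Finset.subset_univ (D.bitNbr i))]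
  · exact Finset.sum_congr rfl fun j hj => by rw [h i j hj]
  · intro j _ hj
    rw [Finset.sum_eq_zero, mul_zero]
    intro B hB
    exact absurd (mem_bitNbr_of_mem_pattern (Finset.mem_filter.1 hB).1 (Finset.mem_filter.1 hB).2) hj

theorem log_lam (D : JointDecoding N M S E) (K₂ : ℝ) (m : Fin N → Fin M → ℝ) (i : Fin N) (e : E) :
    Real.log (D.lam K₂ m i e) = -K₂ * D.Gam m i e := by
  rw [lam, Real.log_exp]

theorem sum_mul_log_lam (D : JointDecoding N M S E) (K₂ : ℝ) (m : Fin N → Fin M → ℝ)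
    (g : Fin N → E → ℝ) :
    ∑ i, ∑ e ∈ D.sec i, g i e * Real.log (D.lam K₂ m i e) =
      -K₂ * (D.cost g - ∑ i, (∑ j ∈ D.bitNbr i, m i j) * D.marg g i) := by
  rw [cost, ← Finset.sum_sub_distrib, Finset.mul_sum]
  refine Finset.sum_congr rfl fun i _ => ?_
  rw [marg, Finset.sum_filter, Finset.mul_sum, ← Finset.sum_sub_distrib, Finset.mul_sum]
  refine Finset.sum_congr rfl fun e _ => ?_
  rw [log_lam, Gam]
  split_ifs <;> ring

theorem check_gibbs (D : JointDecoding N M S E) (K₁ : ℝ) (m : Fin N → Fin M → ℝ) (j : Fin M)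
    (w : Finset (Fin N) → ℝ) (hw : ∀ B ∈ D.patterns j, 0 ≤ w B)
    (hw1 : ∑ B ∈ D.patterns j, w B = 1) :
    ∑ B ∈ D.patterns j, Real.negMulLog (w B) - K₁ * ∑ B ∈ D.patterns j, w B * ∑ i ∈ B, m i j ≤
        Real.log (D.checkPartition K₁ m j) ∧
      (∑ B ∈ D.patterns j, Real.negMulLog (w B) -
          K₁ * ∑ B ∈ D.patterns j, w B * ∑ i ∈ B, m i j = Real.log (D.checkPartition K₁ m j) ↔
        ∀ B ∈ D.patterns j, w B = D.wOf K₁ m j B) := by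
  have h := sum_negMulLog_add_mul_log_le (D.patterns j) w (patWeight K₁ m j) hw
    (fun B _ => (patWeight_pos K₁ m j B).le)
    (fun B _ h => absurd h (patWeight_pos K₁ m j B).ne')
  have hrew : ∑ B ∈ D.patterns j, (Real.negMulLog (w B) + w B * Real.log (patWeight K₁ m j B)) =
      ∑ B ∈ D.patterns j, Real.negMulLog (w B) -
        K₁ * ∑ B ∈ D.patterns j, w B * ∑ i ∈ B, m i j := by
    rw [Finset.sum_add_distrib, sub_eq_add_neg, Finset.mul_sum, ← Finset.sum_neg_distrib]
    congr 1
    refine Finset.sum_congr rfl fun B _ => ?_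
    rw [patWeight, Real.log_exp]; ring
  rw [hw1, Real.negMulLog_one, zero_add, one_mul, hrew] at h
  refine ⟨h.1, h.2.trans (forall₂_congr fun B hB => ?_)⟩
  rw [D.wOf_eq K₁ m j hB, eq_div_iff (D.checkPartition_pos K₁ m j).ne', one_mul]
  rfl

/-- Weak duality between Problem-PS and Problem-DS. Equality holds only at the beliefs. -/
theorem Feasible.dual_le {D : JointDecoding N M S E} (hD : D.AcceptsAllInputs) (hN : 0 < N)
    {K₁ K₂ : ℝ} (hK₁ : 0 < K₁) (hK₂ : 0 < K₂)
    {x : (Fin N → E → ℝ) × (Fin M → Finset (Fin N) → ℝ)} (hx : D.Feasible x)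
    (m : Fin N → Fin M → ℝ) :
    D.dual K₁ K₂ m ≤ D.psObj K₁ K₂ x ∧
      (D.dual K₁ K₂ m = D.psObj K₁ K₂ x ↔ x = (D.gOf K₂ m, D.wOf K₁ m)) := by
  have hT := hx.isFlow.trellisEntropy_add_le hN K₂ m
  have hC := fun j => D.check_gibbs K₁ m j (x.2 j) (hx.w_nonneg j) (hx.w_sum j)
  have hle : ∀ j ∈ (Finset.univ : Finset (Fin M)), (∑ B ∈ D.patterns j, Real.negMulLog (x.2 j B) -
      K₁ * ∑ B ∈ D.patterns j, x.2 j B * ∑ i ∈ B, m i j) -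
        Real.log (D.checkPartition K₁ m j) ≤ 0 := fun j _ => sub_nonpos.2 (hC j).1
  have hsum := Finset.sum_nonpos hle
  -- By the coupling constraints the message terms of the checks and of the trellis cancel, and only
  -- the Gibbs defects remain.
  have hgap : D.dual K₁ K₂ m - D.psObj K₁ K₂ x =
      1 / K₁ * ∑ j, ((∑ B ∈ D.patterns j, Real.negMulLog (x.2 j B) -
        K₁ * ∑ B ∈ D.patterns j, x.2 j B * ∑ i ∈ B, m i j) -
          Real.log (D.checkPartition K₁ m j)) +
      1 / K₂ * ((D.trellisEntropy x.1 +
        ∑ i, ∑ e ∈ D.sec i, x.1 i e * Real.log (D.lam K₂ m i e)) -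
          Real.log (D.partition K₂ m)) := by
    rw [sum_mul_log_lam, Finset.sum_sub_distrib, Finset.sum_sub_distrib, ← Finset.mul_sum,
      sum_pattern_messages (q := D.marg x.1) hx.coupling, dual, psObj]
    simp only [checkEntropy]
    field_simp
    ring
  have h1 : 0 < 1 / K₁ := by positivity
  have h2 : 0 < 1 / K₂ := by positivity
  have hT0 := sub_nonpos.2 hT.1
  have ha := mul_nonpos_of_nonneg_of_nonpos h1.le hsum
  have hb := mul_nonpos_of_nonneg_of_nonpos h2.le hT0
  refine ⟨by linarith, fun heq => ?_, fun heq => ?_⟩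
  · rw [← sub_eq_zero, hgap] at heq
    have ha0 := (mul_eq_zero.1 (le_antisymm ha (by linarith))).resolve_left h1.ne'
    have hb0 := (mul_eq_zero.1 (le_antisymm hb (by linarith))).resolve_left h2.ne'
    have hj := (Finset.sum_eq_zero_iff_of_nonpos hle).1 ha0
    refine Prod.ext (funext fun i => funext fun e => ?_) (funext fun j => funext fun B => ?_)
    · by_cases he : e ∈ D.sec i
      · exact hx.isFlow.eq_gOf hD hN (sub_eq_zero.1 hb0) i he
      · rw [hx.g_off i e he]
        simp [gOf, he]
    · by_cases hB : B ∈ D.patterns j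
      · exact (hC j).2.1 (sub_eq_zero.1 (hj j (Finset.mem_univ j))) B hB
      · rw [hx.w_off j B hB]
        simp [wOf, hB]
  · have hT' := hD.trellisEntropy_gOf hN K₂ m
    rw [← sub_eq_zero, hgap, Finset.sum_eq_zero fun j _ =>
      sub_eq_zero.2 ((hC j).2.2 fun B _ => by rw [heq])]
    rw [heq]
    simp only
    rw [hT', sub_self]; ring

/-! ### Changing the messages of one bit -/

theorem fwd_congr {D : JointDecoding N M S E} {K₂ : ℝ} {m m' : Fin N → Fin M → ℝ} (n : ℕ)
    (h : ∀ i : Fin N, (i : ℕ) < n → D.lam K₂ m i = D.lam K₂ m' i) :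
    D.fwd K₂ m n = D.fwd K₂ m' n := by
  induction n with
  | zero => rfl
  | succ n ih =>
    funext k
    rw [fwd, fwd, ih fun i hi => h i (by omega)]
    split_ifs with hn
    · rw [h ⟨n, hn⟩ (by simp)]
    · rfl

theorem bwd_congr {D : JointDecoding N M S E} {K₂ : ℝ} {m m' : Fin N → Fin M → ℝ} (n : ℕ)
    (h : ∀ i : Fin N, n ≤ (i : ℕ) → D.lam K₂ m i = D.lam K₂ m' i) :
    D.bwd K₂ m n = D.bwd K₂ m' n := by
  have key : ∀ r, r ≤ N - n → D.bwdRev K₂ m r = D.bwdRev K₂ m' r := by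
    intro r
    induction r with
    | zero => intro _; rfl
    | succ r ih =>
      intro hr
      funext k
      rw [bwdRev, bwdRev, ih (by omega)]
      split_ifs with hn
      · rw [h ⟨N - 1 - r, by omega⟩ (by simp; omega)]
      · rfl
  exact key _ le_rfl

theorem Gam_add_single (D : JointDecoding N M S E) (m : Fin N → Fin M → ℝ) (p : Fin N)
    (Δ : Fin M → ℝ) (e : E) :
    D.Gam (m + Pi.single p Δ) p e =
      D.Gam m p e - if D.inp e = true then ∑ j ∈ D.bitNbr p, Δ j else 0 := by
  simp only [Gam, Pi.add_apply, Pi.single_eq_same, Finset.sum_add_distrib]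
  split_ifs <;> ring

theorem lam_add_single_of_ne (D : JointDecoding N M S E) (K₂ : ℝ) (m : Fin N → Fin M → ℝ)
    {p i : Fin N} (Δ : Fin M → ℝ) (h : i ≠ p) :
    D.lam K₂ (m + Pi.single p Δ) i = D.lam K₂ m i := by
  funext e
  simp [lam, Gam, Pi.single_eq_of_ne h]

/-- The messages of bit `p` act only on section `p`: the forward factor sees earlier sections, the
backward factor later ones. -/
theorem weight_add_single (D : JointDecoding N M S E) (K₂ : ℝ) (m : Fin N → Fin M → ℝ) (p : Fin N)
    (Δ : Fin M → ℝ) (e : E) :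
    D.weight K₂ (m + Pi.single p Δ) p e =
      Real.exp (K₂ * if D.inp e = true then ∑ j ∈ D.bitNbr p, Δ j else 0) * D.weight K₂ m p e := by
  rw [weight, weight, fwd_congr (m' := m) p fun i hi => D.lam_add_single_of_ne K₂ m Δ
    (by rintro rfl; omega), bwd_congr (m' := m) (p + 1) fun i hi => D.lam_add_single_of_ne K₂ m Δ
    (by rintro rfl; omega), lam, lam, Gam_add_single, mul_sub, sub_eq_neg_add, Real.exp_add]
  ring_nf

theorem bitMass_add_single_false (D : JointDecoding N M S E) (K₂ : ℝ) (m : Fin N → Fin M → ℝ)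
    (p : Fin N) (Δ : Fin M → ℝ) :
    D.bitMass K₂ (m + Pi.single p Δ) p false = D.bitMass K₂ m p false := by
  refine Finset.sum_congr rfl fun e he => ?_
  simp [weight_add_single, (Finset.mem_filter.1 he).2]

theorem bitMass_add_single_true (D : JointDecoding N M S E) (K₂ : ℝ) (m : Fin N → Fin M → ℝ)
    (p : Fin N) (Δ : Fin M → ℝ) :
    D.bitMass K₂ (m + Pi.single p Δ) p true =
      Real.exp (K₂ * ∑ j ∈ D.bitNbr p, Δ j) * D.bitMass K₂ m p true := by
  rw [bitMass, bitMass, Finset.mul_sum]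
  refine Finset.sum_congr rfl fun e he => ?_
  simp [weight_add_single, (Finset.mem_filter.1 he).2]

theorem sum_add_single (m : Fin N → Fin M → ℝ) (p : Fin N) (Δ : Fin M → ℝ) (j : Fin M)
    (B : Finset (Fin N)) :
    ∑ i ∈ B, (m + Pi.single p Δ : Fin N → Fin M → ℝ) i j =
      ∑ i ∈ B, m i j + if p ∈ B then Δ j else 0 := by
  simp only [Pi.add_apply, Finset.sum_add_distrib]
  congr 1
  rw [← Finset.sum_ite_eq' B p fun _ => Δ j]
  refine Finset.sum_congr rfl fun i _ => ?_
  by_cases h : i = p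
  · subst h; simp
  · simp [h]

theorem checkOut_add_single (D : JointDecoding N M S E) (K₁ : ℝ) (m : Fin N → Fin M → ℝ)
    (p : Fin N) (Δ : Fin M → ℝ) (j : Fin M) :
    D.checkOut K₁ (m + Pi.single p Δ) p j = D.checkOut K₁ m p j := by
  refine Finset.sum_congr rfl fun B hB => ?_
  rw [patWeight, sum_add_single, if_neg (Finset.mem_filter.1 hB).2, add_zero, patWeight]

theorem checkIn_add_single (D : JointDecoding N M S E) (K₁ : ℝ) (m : Fin N → Fin M → ℝ)
    (p : Fin N) (Δ : Fin M → ℝ) (j : Fin M) :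
    D.checkIn K₁ (m + Pi.single p Δ) p j = Real.exp (-K₁ * Δ j) * D.checkIn K₁ m p j := by
  rw [checkIn, checkIn, Finset.mul_sum]
  refine Finset.sum_congr rfl fun B hB => ?_
  rw [patWeight, sum_add_single, if_pos (Finset.mem_filter.1 hB).2, patWeight, ← Real.exp_add]
  ring_nf

theorem log_div_exp_mul {a b t : ℝ} (ha : 0 < a) (hb : 0 < b) :
    Real.log (a / (Real.exp t * b)) = Real.log (a / b) - t := by
  rw [Real.log_div ha.ne' (by positivity), Real.log_mul (Real.exp_pos t).ne' hb.ne', Real.log_exp,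
    Real.log_div ha.ne' hb.ne']
  ring

/-- The effect on the dual function of changing the messages of one bit. -/
theorem dual_add_single {D : JointDecoding N M S E} (hD : D.AcceptsAllInputs)
    (hcheck : ∀ j, (D.checkNbr j).card ≠ 1) (K₁ K₂ : ℝ) (m : Fin N → Fin M → ℝ)
    (p : Fin N) (Δ : Fin M → ℝ) :
    D.dual K₁ K₂ (m + Pi.single p Δ) - D.dual K₁ K₂ m =
      1 / K₁ * ∑ j ∈ D.bitNbr p, (softplus (D.checkLogit K₁ m p j) -
        softplus (D.checkLogit K₁ m p j + K₁ * Δ j)) +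
      1 / K₂ * (softplus (D.bitLogit K₂ m p) -
        softplus (D.bitLogit K₂ m p - K₂ * ∑ j ∈ D.bitNbr p, Δ j)) := by
  set m' := m + Pi.single p Δ with hm'
  -- The partition functions of the trellis and of the adjacent checks are binary sums in the value
  -- of bit `p`, and only the mass of the value one is rescaled.
  have hT : Real.log (D.partition K₂ m') - Real.log (D.partition K₂ m) =
      softplus (D.bitLogit K₂ m p - K₂ * ∑ j ∈ D.bitNbr p, Δ j) - softplus (D.bitLogit K₂ m p) := by
    have h0 : 0 < D.bitMass K₂ m p false := hD.sum_inp_pos K₂ m p false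
    have h1 : 0 < D.bitMass K₂ m p true := hD.sum_inp_pos K₂ m p true
    rw [← D.bitMass_add K₂ m p, ← D.bitMass_add K₂ m' p, hm', bitMass_add_single_false,
      bitMass_add_single_true, log_add_eq_softplus h0 h1, log_add_eq_softplus h0 (by positivity),
      log_div_exp_mul h0 h1, bitLogit]
    ring
  have hC : ∑ j, (Real.log (D.checkPartition K₁ m' j) - Real.log (D.checkPartition K₁ m j)) =
      ∑ j ∈ D.bitNbr p, (softplus (D.checkLogit K₁ m p j + K₁ * Δ j) -
        softplus (D.checkLogit K₁ m p j)) := by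
    rw [← Finset.sum_subset (Finset.subset_univ (D.bitNbr p))]
    · refine Finset.sum_congr rfl fun j hj => ?_
      have h0 := D.checkOut_pos K₁ m p j
      have h1 := checkIn_pos hcheck K₁ m hj
      rw [← D.checkOut_add_checkIn K₁ m p j, ← D.checkOut_add_checkIn K₁ m' p j, hm',
        checkOut_add_single, checkIn_add_single, log_add_eq_softplus h0 h1,
        log_add_eq_softplus h0 (by positivity), log_div_exp_mul h0 h1, checkLogit]
      ring_nf
    · intro j _ hj
      rw [sub_eq_zero]
      congr 1
      refine Finset.sum_congr rfl fun B hB => ?_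
      rw [patWeight, hm', sum_add_single,
        if_neg fun hp => hj (mem_bitNbr_of_mem_pattern hB hp), add_zero, patWeight]
  rw [Finset.sum_sub_distrib] at hC
  have hC' : ∑ j ∈ D.bitNbr p, (softplus (D.checkLogit K₁ m p j) -
      softplus (D.checkLogit K₁ m p j + K₁ * Δ j)) =
      -∑ j ∈ D.bitNbr p, (softplus (D.checkLogit K₁ m p j + K₁ * Δ j) -
        softplus (D.checkLogit K₁ m p j)) := by
    rw [← Finset.sum_neg_distrib]
    exact Finset.sum_congr rfl fun j _ => by ring
  rw [hC', ← hC, dual, dual]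
  linear_combination (-1 / K₂) * hT

/-- Messages at which the checks and the trellis agree on all bit marginals. -/
def IsStationary (D : JointDecoding N M S E) (K₁ K₂ : ℝ) (m : Fin N → Fin M → ℝ) : Prop :=
  ∀ p, ∀ j ∈ D.bitNbr p, D.checkLogit K₁ m p j = D.bitLogit K₂ m p

/-- Maximizers of the dual function are stationary. -/
theorem isStationary_of_forall_dual_le {D : JointDecoding N M S E} (hD : D.AcceptsAllInputs)
    (hcheck : ∀ j, (D.checkNbr j).card ≠ 1) {K₁ K₂ : ℝ} (hK₁ : 0 < K₁) (hK₂ : 0 < K₂)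
    {m : Fin N → Fin M → ℝ} (hm : ∀ m', D.dual K₁ K₂ m' ≤ D.dual K₁ K₂ m) :
    D.IsStationary K₁ K₂ m := by
  intro p j hj
  set t := D.checkLogit K₁ m p j with ht
  set y := D.bitLogit K₂ m p with hy
  -- The step at which the two logits meet: `t + K₁ * d = y - K₂ * d`. The meeting point is a proper
  -- convex combination of `t` and `y`, so the gain is positive unless they coincide.
  set d := (y - t) / (K₁ + K₂) with hd
  have hgain := dual_add_single hD hcheck K₁ K₂ m p (Pi.single j d)
  have hle := hm (m + Pi.single p (Pi.single j d))
  have h1 : ∑ j' ∈ D.bitNbr p, (softplus (D.checkLogit K₁ m p j') -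
      softplus (D.checkLogit K₁ m p j' + K₁ * (Pi.single j d : Fin M → ℝ) j')) =
      softplus t - softplus (t + K₁ * d) := by
    rw [Finset.sum_eq_single_of_mem j hj, Pi.single_eq_same]
    intro j' _ hne
    simp [Pi.single_eq_of_ne hne]
  have h2 : ∑ j' ∈ D.bitNbr p, (Pi.single j d : Fin M → ℝ) j' = d := by
    rw [Finset.sum_pi_single', if_pos hj]
  rw [h1, h2, ← hy] at hgain
  have hJ := softplus_relaxed {()} (fun _ => t) y (K₂ / (K₁ + K₂)) (by positivity)
    (by rw [Finset.card_singleton, Nat.cast_one, one_mul, div_lt_one (by positivity)]; linarith)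
  simp only [Finset.sum_singleton, Finset.mem_singleton, forall_const] at hJ
  have hz1 : y - K₂ / (K₁ + K₂) * (y - t) = y - K₂ * d := by rw [hd]; ring
  have hz2 : t + K₁ * d = y - K₂ * d := by rw [hd]; field_simp; ring
  rw [hz1] at hJ
  rw [hz2] at hgain
  refine hJ.2 (le_antisymm hJ.1 ?_)
  have hneg : 1 / K₁ * (softplus t - softplus (y - K₂ * d)) +
      1 / K₂ * (softplus y - softplus (y - K₂ * d)) ≤ 0 := by linarith
  have hrew : 1 / K₁ * (softplus t - softplus (y - K₂ * d)) +
      1 / K₂ * (softplus y - softplus (y - K₂ * d)) =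
      (K₁ + K₂) / (K₁ * K₂) * (softplus y + K₂ / (K₁ + K₂) * (softplus t - softplus y) -
        softplus (y - K₂ * d)) := by
    field_simp; ring
  rw [hrew] at hneg
  have hpos : 0 < (K₁ + K₂) / (K₁ * K₂) := by positivity
  by_contra hlt
  exact absurd (mul_pos hpos (by linarith)) (not_lt.2 hneg)

/-- At stationary messages the beliefs are feasible. -/
theorem IsStationary.feasible {D : JointDecoding N M S E} (hD : D.AcceptsAllInputs)
    (hcheck : ∀ j, (D.checkNbr j).card ≠ 1) {K₁ K₂ : ℝ} {m : Fin N → Fin M → ℝ}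
    (hm : D.IsStationary K₁ K₂ m) : D.Feasible (D.gOf K₂ m, D.wOf K₁ m) where
  w_sum j := by
    simp only
    rw [Finset.sum_congr rfl fun B hB => D.wOf_eq K₁ m j hB, ← Finset.sum_div]
    exact div_self (D.checkPartition_pos K₁ m j).ne'
  g_sum := (hD.isFlow_gOf K₂ m).g_sum
  coupling i j hj := by
    simp only
    rw [Finset.sum_congr rfl fun B hB => D.wOf_eq K₁ m j (Finset.mem_filter.1 hB).1,
      Finset.sum_congr rfl fun e he => hD.gOf_eq K₂ m i (Finset.mem_filter.1 he).1,
      ← Finset.sum_div, ← Finset.sum_div]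
    change D.checkIn K₁ m i j / _ = D.bitMass K₂ m i true / _
    have h0 := D.checkOut_pos K₁ m i j
    have h1 := checkIn_pos hcheck K₁ m hj
    have h2 : 0 < D.bitMass K₂ m i false := hD.sum_inp_pos K₂ m i false
    have h3 : 0 < D.bitMass K₂ m i true := hD.sum_inp_pos K₂ m i true
    -- Equal logits mean equal odds, hence equal marginals after normalization.
    have h := Real.log_injOn_pos (Set.mem_Ioi.2 (by positivity)) (Set.mem_Ioi.2 (by positivity))
      (hm i j hj)
    rw [← D.checkOut_add_checkIn K₁ m i j, ← D.bitMass_add K₂ m i]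
    rw [div_eq_div_iff h1.ne' h3.ne'] at h
    rw [div_eq_div_iff (by positivity) (by positivity)]
    linear_combination -h
  flow := (hD.isFlow_gOf K₂ m).flow
  w_nonneg j B hB := by
    simp only
    rw [D.wOf_eq K₁ m j hB]
    exact div_nonneg (patWeight_pos K₁ m j B).le (D.checkPartition_pos K₁ m j).le
  g_nonneg := (hD.isFlow_gOf K₂ m).g_nonneg
  w_off j B hB := by simp [wOf, hB]
  g_off i e he := by simp [gOf, he]

theorem IsStationary.dual_eq {D : JointDecoding N M S E} (hD : D.AcceptsAllInputs)
    (hcheck : ∀ j, (D.checkNbr j).card ≠ 1) (hN : 0 < N) {K₁ K₂ : ℝ} (hK₁ : 0 < K₁) (hK₂ : 0 < K₂)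
    {m : Fin N → Fin M → ℝ} (hm : D.IsStationary K₁ K₂ m) :
    D.dual K₁ K₂ m = D.psObj K₁ K₂ (D.gOf K₂ m, D.wOf K₁ m) :=
  ((hm.feasible hD hcheck).dual_le hD hN hK₁ hK₂ m).2.2 rfl

/-! ### Monotonicity of the algorithm -/

/-- By the tanh rule the check message is the old message minus `checkLogit / K₁`. The increment
therefore moves each adjacent check logit onto the old trellis logit. -/
theorem bitUpdate_eq {D : JointDecoding N M S E} (hD : D.AcceptsAllInputs)
    (hcheck : ∀ j, (D.checkNbr j).card ≠ 1) {K₁ : ℝ} (hK₁ : 0 < K₁) (K₂ : ℝ) (p : Fin N)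
    (m : Fin N → Fin M → ℝ) :
    D.bitUpdate K₁ K₂ p m = m + Pi.single p fun j =>
      if j ∈ D.bitNbr p then (D.bitLogit K₂ m p - D.checkLogit K₁ m p j) / K₁ else 0 := by
  funext i j
  rw [bitUpdate, Pi.add_apply, Pi.add_apply]
  by_cases hi : i = p
  · subst hi
    rw [Pi.single_eq_same]
    by_cases hj : j ∈ D.bitNbr i
    · simp only [hj, and_self, if_true]
      rw [checkMsg_eq hcheck hK₁ m hj, hD.gam_eq, bitLogit, bitMass, bitMass]
      ring
    · simp [hj]
  · simp [hi]

/-- The check logits `t j` move to `y`, and the trellis logit moves to `y - (K₂ / K₁) * ∑ j, (y - t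
j)`. By `hp` this is a convex combination with positive weight at `y`, and the gain is `1 / K₂`
times the Jensen defect of `softplus`. -/
theorem dual_le_bitUpdate {D : JointDecoding N M S E} (hD : D.AcceptsAllInputs)
    (hcheck : ∀ j, (D.checkNbr j).card ≠ 1) {K₁ K₂ : ℝ} (hK₁ : 0 < K₁) (hK₂ : 0 < K₂)
    (p : Fin N) (hp : ((D.bitNbr p).card : ℝ) * K₂ < K₁) (m : Fin N → Fin M → ℝ) :
    D.dual K₁ K₂ m ≤ D.dual K₁ K₂ (D.bitUpdate K₁ K₂ p m) ∧
      (D.dual K₁ K₂ (D.bitUpdate K₁ K₂ p m) = D.dual K₁ K₂ m →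
        (∀ j ∈ D.bitNbr p, D.checkLogit K₁ m p j = D.bitLogit K₂ m p) ∧
          D.bitUpdate K₁ K₂ p m = m) := by
  have hb := bitUpdate_eq hD hcheck hK₁ K₂ p m
  set y := D.bitLogit K₂ m p with hy
  set t := D.checkLogit K₁ m p with ht
  have hgain := dual_add_single hD hcheck K₁ K₂ m p fun j =>
      if j ∈ D.bitNbr p then (y - t j) / K₁ else 0
  rw [← hb] at hgain
  have h1 : ∑ j ∈ D.bitNbr p, (softplus (D.checkLogit K₁ m p j) -
      softplus (D.checkLogit K₁ m p j + K₁ * if j ∈ D.bitNbr p then (y - t j) / K₁ else 0)) =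
      ∑ j ∈ D.bitNbr p, (softplus (t j) - softplus y) := by
    refine Finset.sum_congr rfl fun j hj => ?_
    rw [if_pos hj, mul_div_cancel₀ _ hK₁.ne', ht, add_sub_cancel]
  have h2 : K₂ * ∑ j ∈ D.bitNbr p, (if j ∈ D.bitNbr p then (y - t j) / K₁ else 0) =
      K₂ / K₁ * ∑ j ∈ D.bitNbr p, (y - t j) := by
    rw [Finset.sum_congr rfl fun j hj => if_pos hj, ← Finset.sum_div]; ring
  rw [h1, h2, ← hy] at hgain
  have hJ := softplus_relaxed (D.bitNbr p) t y (K₂ / K₁) (by positivity)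
    (by rw [← mul_div_assoc, div_lt_one hK₁]; exact hp)
  have hrew : 1 / K₁ * ∑ j ∈ D.bitNbr p, (softplus (t j) - softplus y) +
      1 / K₂ * (softplus y - softplus (y - K₂ / K₁ * ∑ j ∈ D.bitNbr p, (y - t j))) =
      1 / K₂ * (softplus y + K₂ / K₁ * ∑ j ∈ D.bitNbr p, (softplus (t j) - softplus y) -
        softplus (y - K₂ / K₁ * ∑ j ∈ D.bitNbr p, (y - t j))) := by
    field_simp; ring
  rw [hrew] at hgain
  have hpos : 0 < 1 / K₂ := by positivity
  refine ⟨by linarith [mul_nonneg hpos.le (sub_nonneg.2 hJ.1)], fun h => ?_⟩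
  rw [h, sub_self] at hgain
  have hst := hJ.2 (sub_eq_zero.1 ((mul_eq_zero.1 hgain.symm).resolve_left hpos.ne')).symm
  refine ⟨hst, ?_⟩
  rw [hb]
  funext i j
  by_cases hi : i = p
  · subst hi
    by_cases hj : j ∈ D.bitNbr i
    · simp [hj, hst j hj]
    · simp [hj]
  · simp [Pi.single_eq_of_ne hi]

theorem dual_le_sweep {D : JointDecoding N M S E} (hD : D.AcceptsAllInputs)
    (hcheck : ∀ j, (D.checkNbr j).card ≠ 1) {K₁ K₂ : ℝ} (hK₁ : 0 < K₁) (hK₂ : 0 < K₂)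
    (hK : ∀ i, ((D.bitNbr i).card : ℝ) * K₂ < K₁) (m : Fin N → Fin M → ℝ) :
    D.dual K₁ K₂ m ≤ D.dual K₁ K₂ (D.sweep K₁ K₂ m) ∧
      (D.dual K₁ K₂ (D.sweep K₁ K₂ m) = D.dual K₁ K₂ m → D.IsStationary K₁ K₂ m) := by
  have key : ∀ (L : List (Fin N)) (m : Fin N → Fin M → ℝ),
      D.dual K₁ K₂ m ≤ D.dual K₁ K₂ (L.foldl (fun m' p => D.bitUpdate K₁ K₂ p m') m) ∧
      (D.dual K₁ K₂ (L.foldl (fun m' p => D.bitUpdate K₁ K₂ p m') m) = D.dual K₁ K₂ m →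
        ∀ p ∈ L, ∀ j ∈ D.bitNbr p, D.checkLogit K₁ m p j = D.bitLogit K₂ m p) := by
    intro L
    induction L with
    | nil => intro m; simp
    | cons p L ih =>
      intro m
      rw [List.foldl_cons]
      have hp := dual_le_bitUpdate hD hcheck hK₁ hK₂ p (hK p) m
      have hL := ih (D.bitUpdate K₁ K₂ p m)
      refine ⟨hp.1.trans hL.1, fun h => ?_⟩
      -- Without gain over the whole list the first update is idle, so the remaining conditions are
      -- tested at the same messages.
      have h1 := hp.2 (le_antisymm (h ▸ hL.1) hp.1)
      rw [h1.2] at hL h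
      intro q hq
      rcases List.mem_cons.1 hq with rfl | hq
      · exact h1.1
      · exact hL.2 h q hq
  exact ⟨(key _ m).1, fun h p => (key _ m).2 h p (List.mem_finRange p)⟩

/-! ### Entropy bounds -/

theorem IsFlow.stateEntropy_le {D : JointDecoding N M S E} {g : Fin N → E → ℝ} (hg : D.IsFlow g)
    (i : Fin N) : D.stateEntropy g i ≤ D.sectionEntropy g i := by
  rw [stateEntropy, sectionEntropy, ← Finset.sum_fiberwise (D.sec i) D.dst]
  exact Finset.sum_le_sum fun k _ => negMulLog_sum_le _ _ fun e he =>
    hg.g_nonneg i e (Finset.mem_filter.1 he).1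

theorem IsFlow.stateEntropy_nonneg {D : JointDecoding N M S E} {g : Fin N → E → ℝ}
    (hg : D.IsFlow g) (i : Fin N) : 0 ≤ D.stateEntropy g i := by
  refine Finset.sum_nonneg fun k _ => Real.negMulLog_nonneg
    (Finset.sum_nonneg fun e he => hg.g_nonneg i e (Finset.mem_filter.1 he).1) ?_
  rw [← hg.g_sum i]
  exact Finset.sum_le_sum_of_subset_of_nonneg (Finset.filter_subset _ _)
    fun e he _ => hg.g_nonneg i e he

theorem IsFlow.sectionEntropy_nonneg {D : JointDecoding N M S E} {g : Fin N → E → ℝ}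
    (hg : D.IsFlow g) (i : Fin N) : 0 ≤ D.sectionEntropy g i :=
  (hg.stateEntropy_nonneg i).trans (hg.stateEntropy_le i)

theorem IsFlow.sectionEntropy_le {D : JointDecoding N M S E} {g : Fin N → E → ℝ}
    (hg : D.IsFlow g) (i : Fin N) : D.sectionEntropy g i ≤ (D.sec i).card := by
  refine (Finset.sum_le_sum fun e he => negMulLog_le_one (hg.g_nonneg i e he)).trans ?_
  simp

theorem IsFlow.trellisEntropy_nonneg {D : JointDecoding N M S E} {g : Fin N → E → ℝ}
    (hg : D.IsFlow g) (hN : 0 < N) : 0 ≤ D.trellisEntropy g := by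
  rw [D.trellisEntropy_eq_sum_sub hN]
  exact add_nonneg (Finset.sum_nonneg fun i _ => sub_nonneg.2 (hg.stateEntropy_le i))
    (hg.stateEntropy_nonneg _)

theorem IsFlow.trellisEntropy_le {D : JointDecoding N M S E} {g : Fin N → E → ℝ}
    (hg : D.IsFlow g) : D.trellisEntropy g ≤ ∑ i, ((D.sec i).card : ℝ) := by
  have h1 := Finset.sum_le_sum fun i (_ : i ∈ Finset.univ) => hg.sectionEntropy_le i
  have h2 := Finset.sum_nonneg fun i
    (_ : i ∈ Finset.univ.filter (fun i : Fin N => (i : ℕ) + 1 < N)) => hg.stateEntropy_nonneg i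
  rw [trellisEntropy]
  linarith

theorem Feasible.checkEntropy_nonneg {D : JointDecoding N M S E}
    {x : (Fin N → E → ℝ) × (Fin M → Finset (Fin N) → ℝ)} (hx : D.Feasible x) (j : Fin M) :
    0 ≤ D.checkEntropy x.2 j := by
  refine Finset.sum_nonneg fun B hB => Real.negMulLog_nonneg (hx.w_nonneg j B hB) ?_
  rw [← hx.w_sum j]
  exact Finset.single_le_sum (hx.w_nonneg j) hB

theorem Feasible.checkEntropy_le {D : JointDecoding N M S E}
    {x : (Fin N → E → ℝ) × (Fin M → Finset (Fin N) → ℝ)} (hx : D.Feasible x) (j : Fin M) :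
    D.checkEntropy x.2 j ≤ (D.patterns j).card := by
  refine (Finset.sum_le_sum fun B hB => negMulLog_le_one (hx.w_nonneg j B hB)).trans ?_
  simp

/-! ### Path flows -/

open Classical in
/-- The unit flow along a path. -/
noncomputable def pathFlow (ε : Fin N → E) (i : Fin N) (e : E) : ℝ := if e = ε i then 1 else 0

theorem IsPath.sum_pathFlow {D : JointDecoding N M S E} {ε : Fin N → E} (hε : D.IsPath ε)
    (i : Fin N) (P : E → Prop) [DecidablePred P] :
    ∑ e ∈ D.sec i with P e, pathFlow ε i e = if P (ε i) then 1 else 0 := by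
  classical
  simp [pathFlow, Finset.sum_ite_eq', hε.1 i]

theorem IsPath.isFlow_pathFlow {D : JointDecoding N M S E} {ε : Fin N → E} (hε : D.IsPath ε) :
    D.IsFlow (pathFlow ε) where
  g_sum p := by simpa using hε.sum_pathFlow p fun _ => True
  flow i h k := by rw [hε.sum_pathFlow, hε.sum_pathFlow, hε.2 i h]
  g_nonneg i e _ := by unfold pathFlow; split_ifs <;> norm_num

theorem IsPath.marg_pathFlow {D : JointDecoding N M S E} {ε : Fin N → E} (hε : D.IsPath ε)
    (i : Fin N) : D.marg (pathFlow ε) i = if D.inp (ε i) = true then 1 else 0 :=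
  hε.sum_pathFlow i fun e => D.inp e = true

/-! ### Natural parameters -/

/-- The linear functionals of the messages on which the beliefs depend. -/
def natParam (D : JointDecoding N M S E) :
    (Fin N → Fin M → ℝ) →ₗ[ℝ] (Fin N → ℝ) × (Fin M → Finset (Fin N) → ℝ) where
  toFun m := (fun i => ∑ j ∈ D.bitNbr i, m i j,
    fun j B => if B ∈ D.patterns j then ∑ i ∈ B, m i j else 0)
  map_add' m m' := by
    ext
    · simp [Finset.sum_add_distrib]
    · simp only [Pi.add_apply, Finset.sum_add_distrib, Prod.mk_add_mk]
      split_ifs <;> simp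
  map_smul' c m := by
    ext
    · simp [Finset.mul_sum]
    · simp only [Pi.smul_apply, smul_eq_mul, ← Finset.mul_sum, Prod.smul_mk, RingHom.id_apply]
      split_ifs <;> simp

section Invariance

variable {D : JointDecoding N M S E} {m m' : Fin N → Fin M → ℝ}

theorem lam_eq_of_natParam_eq (h : D.natParam m = D.natParam m') (K₂ : ℝ) (i : Fin N) :
    D.lam K₂ m i = D.lam K₂ m' i := by
  have h1 : ∑ j ∈ D.bitNbr i, m i j = ∑ j ∈ D.bitNbr i, m' i j := congrFun (congrArg Prod.fst h) i
  funext e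
  rw [lam, lam, Gam, Gam, h1]

theorem patWeight_eq_of_natParam_eq (h : D.natParam m = D.natParam m') (K₁ : ℝ) {j : Fin M}
    {B : Finset (Fin N)} (hB : B ∈ D.patterns j) : patWeight K₁ m j B = patWeight K₁ m' j B := by
  have h1 := congrFun (congrFun (congrArg Prod.snd h) j) B
  simp only [natParam, LinearMap.coe_mk, AddHom.coe_mk, if_pos hB] at h1
  rw [patWeight, patWeight, h1]

theorem weight_eq_of_natParam_eq (h : D.natParam m = D.natParam m') (K₂ : ℝ) (i : Fin N) (e : E) :
    D.weight K₂ m i e = D.weight K₂ m' i e := by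
  rw [weight, weight, lam_eq_of_natParam_eq h,
    fwd_congr (m' := m') i fun i _ => lam_eq_of_natParam_eq h K₂ i,
    bwd_congr (m' := m') (i + 1) fun i _ => lam_eq_of_natParam_eq h K₂ i]

theorem partition_eq_of_natParam_eq (h : D.natParam m = D.natParam m') (K₂ : ℝ) :
    D.partition K₂ m = D.partition K₂ m' := by
  rw [partition, partition, bwd_congr (m' := m') 0 fun i _ => lam_eq_of_natParam_eq h K₂ i]

theorem checkPartition_eq_of_natParam_eq (h : D.natParam m = D.natParam m') (K₁ : ℝ) (j : Fin M) :
    D.checkPartition K₁ m j = D.checkPartition K₁ m' j :=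
  Finset.sum_congr rfl fun _ hB => patWeight_eq_of_natParam_eq h K₁ hB

theorem dual_eq_of_natParam_eq (h : D.natParam m = D.natParam m') (K₁ K₂ : ℝ) :
    D.dual K₁ K₂ m = D.dual K₁ K₂ m' := by
  simp only [dual, partition_eq_of_natParam_eq h, checkPartition_eq_of_natParam_eq h]

theorem gOf_eq_of_natParam_eq (hD : D.AcceptsAllInputs) (h : D.natParam m = D.natParam m')
    (K₂ : ℝ) : D.gOf K₂ m = D.gOf K₂ m' := by
  funext i e
  by_cases he : e ∈ D.sec i
  · rw [hD.gOf_eq K₂ m i he, hD.gOf_eq K₂ m' i he, weight_eq_of_natParam_eq h,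
      partition_eq_of_natParam_eq h]
  · simp [gOf, he]

theorem wOf_eq_of_natParam_eq (h : D.natParam m = D.natParam m') (K₁ : ℝ) :
    D.wOf K₁ m = D.wOf K₁ m' := by
  funext j B
  by_cases hB : B ∈ D.patterns j
  · rw [D.wOf_eq K₁ m j hB, D.wOf_eq K₁ m' j hB, patWeight_eq_of_natParam_eq h K₁ hB,
      checkPartition_eq_of_natParam_eq h]
  · simp [wOf, hB]

theorem checkLogit_eq_of_natParam_eq (h : D.natParam m = D.natParam m') (K₁ : ℝ) (i : Fin N)
    (j : Fin M) : D.checkLogit K₁ m i j = D.checkLogit K₁ m' i j := by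
  have h0 : D.checkOut K₁ m i j = D.checkOut K₁ m' i j := Finset.sum_congr rfl fun _ hB =>
    patWeight_eq_of_natParam_eq h K₁ (Finset.mem_filter.1 hB).1
  have h1 : D.checkIn K₁ m i j = D.checkIn K₁ m' i j := Finset.sum_congr rfl fun _ hB =>
    patWeight_eq_of_natParam_eq h K₁ (Finset.mem_filter.1 hB).1
  rw [checkLogit, checkLogit, h0, h1]

theorem bitLogit_eq_of_natParam_eq (h : D.natParam m = D.natParam m') (K₂ : ℝ) (i : Fin N) :
    D.bitLogit K₂ m i = D.bitLogit K₂ m' i := by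
  simp only [bitLogit, bitMass, weight_eq_of_natParam_eq h]

/-- The increments depend on the messages through logits only, so the sweep descends to the quotient
by the kernel of `natParam`. -/
theorem natParam_sweep_eq (hD : D.AcceptsAllInputs) (hcheck : ∀ j, (D.checkNbr j).card ≠ 1)
    {K₁ : ℝ} (hK₁ : 0 < K₁) (K₂ : ℝ) (h : D.natParam m = D.natParam m') :
    D.natParam (D.sweep K₁ K₂ m) = D.natParam (D.sweep K₁ K₂ m') := by
  rw [sweep, sweep]
  generalize List.finRange N = L
  induction L generalizing m m' with
  | nil => exact h
  | cons p L ih =>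
    rw [List.foldl_cons, List.foldl_cons]
    apply ih
    rw [bitUpdate_eq hD hcheck hK₁, bitUpdate_eq hD hcheck hK₁, map_add, map_add, h]
    simp only [bitLogit_eq_of_natParam_eq h, checkLogit_eq_of_natParam_eq h]

end Invariance

/-! ### Continuity -/

theorem continuous_lam (D : JointDecoding N M S E) (K₂ : ℝ) (i : Fin N) (e : E) :
    Continuous fun m => D.lam K₂ m i e := by
  unfold lam Gam
  split_ifs <;> fun_prop

theorem continuous_fwd (D : JointDecoding N M S E) (K₂ : ℝ) (i : ℕ) (k : S) :
    Continuous fun m => D.fwd K₂ m i k := by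
  induction i generalizing k with
  | zero => exact continuous_const
  | succ i ih =>
    simp only [fwd]
    split_ifs
    · exact continuous_finsetSum _ fun e _ => (ih _).mul (D.continuous_lam _ _ _)
    · exact continuous_const

theorem continuous_bwd (D : JointDecoding N M S E) (K₂ : ℝ) (i : ℕ) (k : S) :
    Continuous fun m => D.bwd K₂ m i k := by
  simp only [bwd]
  generalize N - i = r
  induction r generalizing k with
  | zero => exact continuous_const
  | succ i ih =>
    simp only [bwdRev]
    split_ifs
    · exact continuous_finsetSum _ fun e _ => (ih _).mul (D.continuous_lam _ _ _)
    · exact continuous_const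

theorem continuous_weight (D : JointDecoding N M S E) (K₂ : ℝ) (i : Fin N) (e : E) :
    Continuous fun m => D.weight K₂ m i e :=
  ((D.continuous_fwd K₂ i _).mul (D.continuous_lam _ _ _)).mul (D.continuous_bwd K₂ _ _)

theorem continuous_partition (D : JointDecoding N M S E) (K₂ : ℝ) :
    Continuous fun m => D.partition K₂ m :=
  continuous_finsetSum _ fun k _ => D.continuous_bwd K₂ 0 k

theorem continuous_patWeight (K₁ : ℝ) (j : Fin M) (B : Finset (Fin N)) :
    Continuous fun m => patWeight K₁ m j B := by
  unfold patWeight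
  fun_prop

theorem continuous_checkPartition (D : JointDecoding N M S E) (K₁ : ℝ) (j : Fin M) :
    Continuous fun m => D.checkPartition K₁ m j :=
  continuous_finsetSum _ fun B _ => continuous_patWeight K₁ j B

theorem continuous_dual {D : JointDecoding N M S E} (hD : D.AcceptsAllInputs) (hN : 0 < N)
    (K₁ K₂ : ℝ) : Continuous (D.dual K₁ K₂) :=
  (continuous_const.mul (continuous_finsetSum _ fun j _ =>
    (D.continuous_checkPartition K₁ j).log fun m => (D.checkPartition_pos K₁ m j).ne')).sub
  (continuous_const.mul ((D.continuous_partition K₂).log fun m => (hD.partition_pos hN K₂ m).ne'))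

theorem continuous_gOf {D : JointDecoding N M S E} (hD : D.AcceptsAllInputs) (K₂ : ℝ) :
    Continuous (D.gOf K₂) := by
  refine continuous_pi fun i => continuous_pi fun e => ?_
  by_cases he : e ∈ D.sec i
  · simp only [hD.gOf_eq K₂ _ i he]
    exact (D.continuous_weight K₂ i e).div (D.continuous_partition K₂)
      fun m => (hD.partition_pos i.pos K₂ m).ne'
  · simp only [gOf, he, if_false]
    exact continuous_const

theorem continuous_wOf (D : JointDecoding N M S E) (K₁ : ℝ) : Continuous (D.wOf K₁) := by
  refine continuous_pi fun j => continuous_pi fun B => ?_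
  by_cases hB : B ∈ D.patterns j
  · simp only [D.wOf_eq K₁ _ j hB]
    exact (continuous_patWeight K₁ j B).div (D.continuous_checkPartition K₁ j)
      fun m => (D.checkPartition_pos K₁ m j).ne'
  · simp only [wOf, hB, if_false]
    exact continuous_const

theorem continuous_bitLogit {D : JointDecoding N M S E} (hD : D.AcceptsAllInputs) (K₂ : ℝ)
    (i : Fin N) : Continuous fun m => D.bitLogit K₂ m i := by
  have h := fun c => (continuous_finsetSum ((D.sec i).filter fun e => D.inp e = c)
    fun e _ => D.continuous_weight K₂ i e)
  exact ((h false).div (h true) fun m => (hD.sum_inp_pos K₂ m i true).ne').log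
    fun m => (div_pos (hD.sum_inp_pos K₂ m i false) (hD.sum_inp_pos K₂ m i true)).ne'

theorem continuous_checkLogit {D : JointDecoding N M S E} (hcheck : ∀ j, (D.checkNbr j).card ≠ 1)
    (K₁ : ℝ) {i : Fin N} {j : Fin M} (hij : j ∈ D.bitNbr i) :
    Continuous fun m => D.checkLogit K₁ m i j := by
  have hin : Continuous fun m => D.checkIn K₁ m i j :=
    continuous_finsetSum _ fun B _ => continuous_patWeight K₁ j B
  have hout : Continuous fun m => D.checkOut K₁ m i j :=
    continuous_finsetSum _ fun B _ => continuous_patWeight K₁ j B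
  exact (hout.div hin fun m => (checkIn_pos hcheck K₁ m hij).ne').log
    fun m => (div_pos (D.checkOut_pos K₁ m i j) (checkIn_pos hcheck K₁ m hij)).ne'

theorem continuous_sweep {D : JointDecoding N M S E} (hD : D.AcceptsAllInputs)
    (hcheck : ∀ j, (D.checkNbr j).card ≠ 1) {K₁ : ℝ} (hK₁ : 0 < K₁) (K₂ : ℝ) :
    Continuous (D.sweep K₁ K₂) := by
  have hb : ∀ p, Continuous (D.bitUpdate K₁ K₂ p) := by
    intro p
    rw [funext fun m => bitUpdate_eq hD hcheck hK₁ K₂ p m]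
    refine continuous_id.add ?_
    refine (continuous_single p).comp (continuous_pi fun j => ?_)
    split_ifs with hj
    · exact ((continuous_bitLogit hD K₂ p).sub (continuous_checkLogit hcheck K₁ hj)).div_const _
    · exact continuous_const
  unfold sweep
  generalize List.finRange N = L
  induction L with
  | nil => exact continuous_id
  | cons p L ih => exact ih.comp (hb p)

/-! ### Coercivity -/

/-- At zero messages the even and odd subsets of the other bits balance, because the product of the
factors `1 - 1` is not empty. Uniform patterns thus have all marginals one half. -/
theorem two_mul_card_filter_patterns {D : JointDecoding N M S E}
    (hcheck : ∀ j, (D.checkNbr j).card ≠ 1) {i : Fin N} {j : Fin M} (hij : j ∈ D.bitNbr i) :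
    2 * (((D.patterns j).filter fun B => i ∈ B).card : ℝ) = (D.patterns j).card := by
  have hi := mem_bitNbr.1 hij
  have h := D.checkOut_add_checkIn 0 0 i j
  have hsub := sum_even_sub_sum_odd ((D.checkNbr j).erase i)
    fun r => Real.exp (-0 * (0 : Fin N → Fin M → ℝ) r j)
  have hne : ((D.checkNbr j).erase i).card ≠ 0 := by
    have := Finset.card_erase_add_one hi
    have := hcheck j
    omega
  have hin := D.checkIn_eq 0 0 hij
  rw [← checkOut_eq] at hsub
  rw [Finset.prod_congr rfl (g := fun _ => (0 : ℝ)) (fun r _ => by simp), Finset.prod_const,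
    zero_pow hne] at hsub
  have hin1 : D.checkIn 0 0 i j = (((D.patterns j).filter fun B => i ∈ B).card : ℝ) := by
    simp [checkIn, patWeight]
  have hpart : D.checkPartition 0 0 j = (D.patterns j).card := by
    simp [checkPartition, patWeight]
  rw [← hin1, ← hpart]
  simp only [neg_zero, zero_mul, Real.exp_zero, one_mul] at hin hsub
  linarith

/-- The dual is a sum of soft minima `a j` and `aT`, each below all of its competitors: the pattern
sums, respectively the costs of input words. Uniform patterns and a pair of complementary words all
have marginals one half, so the messages cancel in the total excess of the competitors. A lower
bound on the dual then bounds every single excess, and differences of excesses give the natural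
parameters. -/
theorem exists_bound_natParam {D : JointDecoding N M S E} (hD : D.AcceptsAllInputs) (hN : 0 < N)
    (hcheck : ∀ j, (D.checkNbr j).card ≠ 1) {K₁ K₂ : ℝ} (hK₁ : 0 < K₁) (hK₂ : 0 < K₂) (F : ℝ) :
    ∃ C : ℝ, ∀ m, F ≤ D.dual K₁ K₂ m → ‖D.natParam m‖ ≤ C := by
  choose ε hε hinp using hD
  set c : (Fin N → Bool) → ℝ := fun u => D.cost (pathFlow (ε u))
  set β : ℝ := ∑ u, |c u|
  have hcβ : ∀ u, |c u| ≤ β := fun u =>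
    Finset.single_le_sum (f := fun u => |c u|) (fun u _ => abs_nonneg _) (Finset.mem_univ u)
  set Q : ℝ := ∑ j, ((D.patterns j).card : ℝ)
  have hQ : ∀ j, ((D.patterns j).card : ℝ) ≤ Q := fun j =>
    Finset.single_le_sum (f := fun j => ((D.patterns j).card : ℝ))
      (fun j _ => Nat.cast_nonneg _) (Finset.mem_univ j)
  refine ⟨Q * (β - F) + 2 * (β - F) + 2 * β, fun m hm => ?_⟩
  set μ : Fin N → ℝ := fun i => ∑ j ∈ D.bitNbr i, m i j
  set a : Fin M → ℝ := fun j => -(1 / K₁) * Real.log (D.checkPartition K₁ m j) with ha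
  set aT : ℝ := -(1 / K₂) * Real.log (D.partition K₂ m) with haT
  have hdual : D.dual K₁ K₂ m = ∑ j, a j + aT := by
    rw [dual, ha, ← Finset.mul_sum, haT]; ring
  have hlow : ∀ j, ∀ B ∈ D.patterns j, a j ≤ ∑ i ∈ B, m i j := by
    intro j B hB
    have h1 : patWeight K₁ m j B ≤ D.checkPartition K₁ m j :=
      Finset.single_le_sum (f := patWeight K₁ m j) (fun B _ => (patWeight_pos K₁ m j B).le) hB
    have h2 := Real.log_le_log (patWeight_pos K₁ m j B) h1
    rw [patWeight, Real.log_exp] at h2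
    have h3 := mul_le_mul_of_nonneg_left h2 (by positivity : (0 : ℝ) ≤ 1 / K₁)
    have h4 : 1 / K₁ * (-K₁ * ∑ i ∈ B, m i j) = -∑ i ∈ B, m i j := by field_simp
    rw [h4] at h3
    rw [ha]
    simp only
    linarith
  -- The unit flow along a path with input `u` is a test flow in the variational formula; its
  -- entropy is nonnegative and can be dropped.
  have hlowT : ∀ u : Fin N → Bool, aT ≤ c u - ∑ i, if u i = true then μ i else 0 := by
    intro u
    have hf := (hε u).isFlow_pathFlow
    have h1 := (hf.trellisEntropy_add_le hN K₂ m).1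
    have h2 := hf.trellisEntropy_nonneg hN
    rw [sum_mul_log_lam] at h1
    have h3 : ∑ i, (∑ j ∈ D.bitNbr i, m i j) * D.marg (pathFlow (ε u)) i =
        ∑ i, if u i = true then μ i else 0 := by
      refine Finset.sum_congr rfl fun i _ => ?_
      rw [(hε u).marg_pathFlow, hinp, mul_ite, mul_one, mul_zero]
    rw [h3] at h1
    have h4 := mul_le_mul_of_nonneg_left (h2.trans (by linarith : D.trellisEntropy _ ≤
      Real.log (D.partition K₂ m) + K₂ * (c u - ∑ i, if u i = true then μ i else 0)))
      (by positivity : (0 : ℝ) ≤ 1 / K₂)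
    rw [mul_zero, mul_add, ← mul_assoc (1 / K₂), one_div_mul_cancel hK₂.ne', one_mul] at h4
    rw [haT]
    linarith
  set U : Fin M → ℝ := fun j => ∑ B ∈ D.patterns j, ((D.patterns j).card : ℝ)⁻¹ * ∑ i ∈ B, m i j
  have hcard : ∀ j, (0 : ℝ) < (D.patterns j).card := fun j =>
    Nat.cast_pos.2 (Finset.card_pos.2 ⟨∅, D.empty_mem_patterns j⟩)
  have hU : ∑ j, U j = 1 / 2 * ∑ i, μ i := by
    have h := sum_pattern_messages (D := D) (w := fun j _ => ((D.patterns j).card : ℝ)⁻¹)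
      (q := fun _ => 1 / 2) (fun i j hj => by
        have h1 := two_mul_card_filter_patterns hcheck hj
        rw [Finset.sum_const, nsmul_eq_mul, ← h1]
        have h2 : (((D.patterns j).filter fun B => i ∈ B).card : ℝ) ≠ 0 := by
          intro h0
          rw [h0, mul_zero] at h1
          exact (hcard j).ne h1
        field_simp) m
    rw [h, ← Finset.sum_mul, mul_comm]
  -- One nonnegative excess is at most their sum, which is the number of patterns times the mean
  -- excess.
  have hUa : ∀ j, ∀ B ∈ D.patterns j, ∑ i ∈ B, m i j - a j ≤ (D.patterns j).card * (U j - a j) := by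
    intro j B hB
    have h1 : (D.patterns j).card * (U j - a j) =
        ∑ B ∈ D.patterns j, (∑ i ∈ B, m i j - a j) := by
      have hUj : U j = ((D.patterns j).card : ℝ)⁻¹ * ∑ B ∈ D.patterns j, ∑ i ∈ B, m i j :=
        (Finset.mul_sum _ _ _).symm
      rw [Finset.sum_sub_distrib, Finset.sum_const, nsmul_eq_mul, mul_sub, hUj,
        ← mul_assoc, mul_inv_cancel₀ (hcard j).ne', one_mul]
    rw [h1]
    exact Finset.single_le_sum (f := fun B => ∑ i ∈ B, m i j - a j)
      (fun B hB => sub_nonneg.2 (hlow j B hB)) hB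
  have hUnn : ∀ j ∈ (Finset.univ : Finset (Fin M)), 0 ≤ U j - a j := by
    intro j _
    have h1 := hUa j ∅ (D.empty_mem_patterns j)
    have h2 := hlow j ∅ (D.empty_mem_patterns j)
    by_contra hneg
    have := mul_neg_of_pos_of_neg (hcard j) (not_le.1 hneg)
    linarith
  have hpair : ∀ u : Fin N → Bool,
      (c u - (∑ i, if u i = true then μ i else 0) - aT) + 2 * ∑ j, (U j - a j) ≤ 2 * (β - F) := by
    intro u
    -- The complementary word turns the sum of `μ` over `u` into the total of `μ`, which twice the
    -- uniform pattern average cancels.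
    have h1 := hlowT fun i => !(u i)
    have h2 : (∑ i, if u i = true then μ i else 0) +
        (∑ i, if (!(u i)) = true then μ i else 0) = ∑ i, μ i := by
      rw [← Finset.sum_add_distrib]
      exact Finset.sum_congr rfl fun i _ => by cases u i <;> simp
    have h3 := (abs_le.1 (hcβ u)).2
    have h4 := (abs_le.1 (hcβ fun i => !(u i))).2
    rw [Finset.sum_sub_distrib, hU]
    linarith
  have hUle : ∀ j, U j - a j ≤ β - F := by
    intro j
    have h1 := hpair fun _ => false
    have h2 := hlowT fun _ => false
    have h3 := Finset.single_le_sum hUnn (Finset.mem_univ j)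
    linarith
  have hTle : ∀ u : Fin N → Bool, c u - (∑ i, if u i = true then μ i else 0) - aT ≤ 2 * (β - F) := by
    intro u
    have h1 := hpair u
    have h2 := Finset.sum_nonneg hUnn
    linarith
  have hβ0 : 0 ≤ β := Finset.sum_nonneg fun u _ => abs_nonneg _
  have hC0 : 0 ≤ β - F := by
    have h1 := hTle fun _ => false
    have h2 := hlowT fun _ => false
    linarith
  have hQ0 : 0 ≤ Q := Finset.sum_nonneg fun j _ => Nat.cast_nonneg _
  have hQC : 0 ≤ Q * (β - F) := mul_nonneg hQ0 hC0
  have hC : 0 ≤ Q * (β - F) + 2 * (β - F) + 2 * β := by linarith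
  refine norm_prod_le_iff.2 ⟨(pi_norm_le_iff_of_nonneg hC).2 fun i => ?_,
    (pi_norm_le_iff_of_nonneg hC).2 fun j => (pi_norm_le_iff_of_nonneg hC).2 fun B => ?_⟩
  · change ‖μ i‖ ≤ _
    -- Comparing the word with a single one at `i` to the zero word isolates `μ i`.
    set u : Fin N → Bool := fun i' => decide (i' = i)
    have hs : ∑ i', (if u i' = true then μ i' else 0) = μ i := by simp [u]
    have hs0 : ∑ i', (if (fun _ : Fin N => false) i' = true then μ i' else 0) = 0 := by simp
    have h1 := hTle u
    have h2 := hlowT u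
    have h3 := hTle fun _ => false
    have h4 := hlowT fun _ => false
    have h5 := abs_le.1 (hcβ u)
    have h6 := abs_le.1 (hcβ fun _ => false)
    rw [hs] at h1 h2
    rw [hs0] at h3 h4
    rw [Real.norm_eq_abs, abs_le]
    constructor <;> linarith [h5.1, h5.2, h6.1, h6.2]
  · change ‖if B ∈ D.patterns j then ∑ i ∈ B, m i j else 0‖ ≤ _
    split_ifs with hB
    · have h1 := hUa j B hB
      -- The empty pattern has sum zero and so anchors `a j`.
      have h2 := hUa j ∅ (D.empty_mem_patterns j)
      have h3 := hlow j B hB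
      have h4 := hlow j ∅ (D.empty_mem_patterns j)
      rw [Finset.sum_empty] at h2 h4
      have h5 : (D.patterns j).card * (U j - a j) ≤ Q * (β - F) :=
        mul_le_mul (hQ j) (hUle j) (hUnn j (Finset.mem_univ j)) hQ0
      rw [Real.norm_eq_abs, abs_le]
      constructor <;> linarith
    · simpa using hC

/-- Messages of bounded norm represent all natural parameters on superlevel sets of the dual. -/
theorem exists_bounded_representative {D : JointDecoding N M S E} (hD : D.AcceptsAllInputs)
    (hN : 0 < N) (hcheck : ∀ j, (D.checkNbr j).card ≠ 1) {K₁ K₂ : ℝ} (hK₁ : 0 < K₁) (hK₂ : 0 < K₂)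
    (F : ℝ) : ∃ R : ℝ, ∀ m, F ≤ D.dual K₁ K₂ m →
      ∃ n ∈ Metric.closedBall (0 : Fin N → Fin M → ℝ) R, D.natParam n = D.natParam m := by
  obtain ⟨C, hC⟩ := exists_bound_natParam hD hN hcheck hK₁ hK₂ F
  obtain ⟨L, hL⟩ := D.natParam.exists_bounded_lift
  refine ⟨|L| * C, fun m hm => ?_⟩
  obtain ⟨n, hn, hnorm⟩ := hL m
  refine ⟨n, mem_closedBall_zero_iff.2 (hnorm.trans ?_), hn⟩
  exact mul_le_mul (le_abs_self L) (hC m hm) (norm_nonneg _) (abs_nonneg L)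

/-- Superlevel sets are bounded only modulo the kernel of `natParam`. The dual is constant along
that kernel, so maximizing over a ball suffices. -/
theorem exists_forall_dual_le {D : JointDecoding N M S E} (hD : D.AcceptsAllInputs)
    (hN : 0 < N) (hcheck : ∀ j, (D.checkNbr j).card ≠ 1) {K₁ K₂ : ℝ} (hK₁ : 0 < K₁)
    (hK₂ : 0 < K₂) : ∃ m, ∀ m', D.dual K₁ K₂ m' ≤ D.dual K₁ K₂ m := by
  obtain ⟨R, hR⟩ := exists_bounded_representative hD hN hcheck hK₁ hK₂ (D.dual K₁ K₂ 0)
  obtain ⟨n₀, hn₀, hn₀'⟩ := hR 0 le_rfl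
  obtain ⟨m, -, hm⟩ := (isCompact_closedBall (0 : Fin N → Fin M → ℝ) R).exists_isMaxOn ⟨n₀, hn₀⟩
    (continuous_dual hD hN K₁ K₂).continuousOn
  refine ⟨m, fun m' => ?_⟩
  rcases le_total (D.dual K₁ K₂ 0) (D.dual K₁ K₂ m') with h | h
  · obtain ⟨n, hn, hn'⟩ := hR m' h
    rw [← dual_eq_of_natParam_eq hn']
    exact hm hn
  · rw [← dual_eq_of_natParam_eq hn₀'] at h
    exact h.trans (hm hn₀)

/-! ### Convergence of the algorithm -/

theorem iter_succ (D : JointDecoding N M S E) (K₁ K₂ : ℝ) (l : ℕ) :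
    D.iter K₁ K₂ (l + 1) = D.sweep K₁ K₂ (D.iter K₁ K₂ l) :=
  Function.iterate_succ_apply' _ _ _

/-- A continuous function of the natural parameters that is constant on stationary messages
converges along the iterates. -/
theorem tendsto_iter {D : JointDecoding N M S E} (hD : D.AcceptsAllInputs)
    (hN : 0 < N) (hcheck : ∀ j, (D.checkNbr j).card ≠ 1) {K₁ K₂ : ℝ} (hK₁ : 0 < K₁)
    (hK₂ : 0 < K₂) (hK : ∀ i, ((D.bitNbr i).card : ℝ) * K₂ < K₁) {X : Type*} [TopologicalSpace X]
    {f : (Fin N → Fin M → ℝ) → X} (hf : Continuous f)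
    (hinv : ∀ m m', D.natParam m = D.natParam m' → f m = f m') {x : X}
    (hx : ∀ n, D.IsStationary K₁ K₂ n → f n = x) :
    Tendsto (fun l => f (D.iter K₁ K₂ l)) atTop (𝓝 x) := by
  have hmono : Monotone fun l => D.dual K₁ K₂ (D.iter K₁ K₂ l) :=
    monotone_nat_of_le_succ fun l => by
      rw [iter_succ]
      exact (dual_le_sweep hD hcheck hK₁ hK₂ hK _).1
  obtain ⟨mmax, hmax⟩ := exists_forall_dual_le hD hN hcheck hK₁ hK₂
  have hlim := tendsto_atTop_ciSup hmono ⟨D.dual K₁ K₂ mmax, by rintro _ ⟨l, rfl⟩; exact hmax _⟩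
  set F := ⨆ l, D.dual K₁ K₂ (D.iter K₁ K₂ l)
  obtain ⟨R, hR⟩ := exists_bounded_representative hD hN hcheck hK₁ hK₂
    (D.dual K₁ K₂ (D.iter K₁ K₂ 0))
  -- Only the natural parameters of the iterates are known to be bounded, so compactness is applied
  -- to bounded representatives.
  choose n hn hn' using fun l => hR (D.iter K₁ K₂ l) (hmono (Nat.zero_le l))
  refine tendsto_of_subseq_tendsto fun φ hφ => ?_
  obtain ⟨a, -, ψ, hψ, ha⟩ :=
    (isCompact_closedBall (0 : Fin N → Fin M → ℝ) R).tendsto_subseq fun l => hn (φ l)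
  have hcd := continuous_dual hD hN K₁ K₂
  have hφψ := hφ.comp hψ.tendsto_atTop
  have h1 : D.dual K₁ K₂ a = F := by
    refine tendsto_nhds_unique ((hcd.tendsto a).comp ha) ?_
    refine (hlim.comp hφψ).congr fun l => ?_
    exact (dual_eq_of_natParam_eq (hn' _) K₁ K₂).symm
  -- Sweeping a representative yields the natural parameters of the next iterate. The limit point
  -- therefore gains nothing from a sweep and is stationary.
  have h2 : D.dual K₁ K₂ (D.sweep K₁ K₂ a) = F := by
    refine tendsto_nhds_unique
      (((hcd.comp (continuous_sweep hD hcheck hK₁ K₂)).tendsto a).comp ha) ?_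
    refine (hlim.comp ((tendsto_add_atTop_nat 1).comp hφψ)).congr fun l => ?_
    change D.dual K₁ K₂ (D.iter K₁ K₂ (φ (ψ l) + 1)) = D.dual K₁ K₂ (D.sweep K₁ K₂ (n (φ (ψ l))))
    rw [iter_succ]
    exact (dual_eq_of_natParam_eq (natParam_sweep_eq hD hcheck hK₁ K₂ (hn' _)) K₁ K₂).symm
  have hst := (dual_le_sweep hD hcheck hK₁ hK₂ hK a).2 (h2.trans h1.symm)
  refine ⟨ψ, ?_⟩
  rw [← hx a hst]
  exact ((hf.tendsto a).comp ha).congr fun l => hinv _ _ (hn' _)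

/-! ### The primal problems -/

theorem isClosed_feasibleSet (D : JointDecoding N M S E) : IsClosed D.feasibleSet := by
  have h : D.feasibleSet =
      {x | (∀ j, ∑ B ∈ D.patterns j, x.2 j B = 1) ∧ (∀ p, ∑ e ∈ D.sec p, x.1 p e = 1) ∧
        (∀ i, ∀ j ∈ D.bitNbr i, ∑ B ∈ D.patterns j with i ∈ B, x.2 j B =
          ∑ e ∈ D.sec i with D.inp e = true, x.1 i e) ∧
        (∀ (i : ℕ) (h : i + 1 < N) (k : S),
          ∑ e ∈ D.sec ⟨i, Nat.lt_of_succ_lt h⟩ with D.dst e = k, x.1 ⟨i, Nat.lt_of_succ_lt h⟩ e =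
            ∑ e ∈ D.sec ⟨i + 1, h⟩ with D.src e = k, x.1 ⟨i + 1, h⟩ e) ∧
        (∀ j, ∀ B ∈ D.patterns j, 0 ≤ x.2 j B) ∧ (∀ i, ∀ e ∈ D.sec i, 0 ≤ x.1 i e) ∧
        (∀ j, ∀ B, B ∉ D.patterns j → x.2 j B = 0) ∧
        (∀ i, ∀ e, e ∉ D.sec i → x.1 i e = 0)} := by
    ext x
    exact ⟨fun h => ⟨h.1, h.2, h.3, h.4, h.5, h.6, h.7, h.8⟩,
      fun ⟨h1, h2, h3, h4, h5, h6, h7, h8⟩ => ⟨h1, h2, h3, h4, h5, h6, h7, h8⟩⟩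
  rw [h]
  simp only [Set.ofPred_and, Set.ofPred_forall]
  refine IsClosed.inter ?_ (IsClosed.inter ?_ (IsClosed.inter ?_ (IsClosed.inter ?_
    (IsClosed.inter ?_ (IsClosed.inter ?_ (IsClosed.inter ?_ ?_)))))) <;>
  repeat' refine isClosed_iInter fun _ => ?_
  all_goals first
    | exact isClosed_eq (by fun_prop) (by fun_prop)
    | exact isClosed_le (by fun_prop) (by fun_prop)

/-- All entries lie in `[0, 1]`, those off the finite supports being zero, so Tychonoff's theorem
applies even for infinite `E`. -/
theorem isCompact_feasibleSet (D : JointDecoding N M S E) : IsCompact D.feasibleSet := by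
  have hK : IsCompact ((Set.univ.pi fun _ : Fin N => Set.univ.pi fun _ : E => Set.Icc (0 : ℝ) 1) ×ˢ
      (Set.univ.pi fun _ : Fin M => Set.univ.pi fun _ : Finset (Fin N) => Set.Icc (0 : ℝ) 1)) :=
    (isCompact_univ_pi fun _ => isCompact_univ_pi fun _ => isCompact_Icc).prod
      (isCompact_univ_pi fun _ => isCompact_univ_pi fun _ => isCompact_Icc)
  refine hK.of_isClosed_subset D.isClosed_feasibleSet fun x hx => ⟨fun i _ e _ => ?_, fun j _ B _ => ?_⟩
  · by_cases he : e ∈ D.sec i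
    · refine ⟨hx.g_nonneg i e he, ?_⟩
      rw [← hx.g_sum i]
      exact Finset.single_le_sum (hx.g_nonneg i) he
    · rw [hx.g_off i e he]; simp
  · by_cases hB : B ∈ D.patterns j
    · refine ⟨hx.w_nonneg j B hB, ?_⟩
      rw [← hx.w_sum j]
      exact Finset.single_le_sum (hx.w_nonneg j) hB
    · rw [hx.w_off j B hB]; simp

theorem continuous_cost (D : JointDecoding N M S E) : Continuous D.cost := by
  unfold cost
  fun_prop

theorem continuous_psObjAt (D : JointDecoding N M S E) (K₁ K₂ : ℝ) (p : Fin N) :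
    Continuous (D.psObjAt K₁ K₂ p) := by
  unfold psObjAt checkEntropy sectionEntropy
  refine ((D.continuous_cost.comp continuous_fst).sub (continuous_const.mul
    (continuous_finsetSum _ fun j _ => continuous_finsetSum _ fun B _ =>
      Real.continuous_negMulLog.comp (by fun_prop)))).sub (continuous_const.mul
    (continuous_finsetSum _ fun e _ => Real.continuous_negMulLog.comp (by fun_prop)))

/-- A bound for the sum of all the entropies. -/
def entropyBound (D : JointDecoding N M S E) : ℝ :=
  ∑ j, ((D.patterns j).card : ℝ) + ∑ i, ((D.sec i).card : ℝ)

theorem entropyBound_nonneg (D : JointDecoding N M S E) : 0 ≤ D.entropyBound :=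
  add_nonneg (Finset.sum_nonneg fun _ _ => Nat.cast_nonneg _)
    (Finset.sum_nonneg fun _ _ => Nat.cast_nonneg _)

/-- The number `h` stands for the full trellis entropy or for that of one section, so one estimate
covers both regularized problems. -/
theorem Feasible.sub_entropies_mem {D : JointDecoding N M S E}
    {x : (Fin N → E → ℝ) × (Fin M → Finset (Fin N) → ℝ)} (hx : D.Feasible x) {K₀ K₁ K₂ h : ℝ}
    (hK₀ : 0 < K₀) (hK₁ : K₀ ≤ K₁) (hK₂ : K₀ ≤ K₂) (h0 : 0 ≤ h)
    (h1 : h ≤ ∑ i, ((D.sec i).card : ℝ)) :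
    D.cost x.1 - D.entropyBound / K₀ ≤
        D.cost x.1 - 1 / K₁ * ∑ j, D.checkEntropy x.2 j - 1 / K₂ * h ∧
      D.cost x.1 - 1 / K₁ * ∑ j, D.checkEntropy x.2 j - 1 / K₂ * h ≤ D.cost x.1 := by
  have hw0 := Finset.sum_nonneg fun j (_ : j ∈ Finset.univ) => hx.checkEntropy_nonneg j
  have hw1 := Finset.sum_le_sum fun j (_ : j ∈ Finset.univ) => hx.checkEntropy_le j
  have hi1 : 1 / K₁ ≤ 1 / K₀ := one_div_le_one_div_of_le hK₀ hK₁
  have hi2 : 1 / K₂ ≤ 1 / K₀ := one_div_le_one_div_of_le hK₀ hK₂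
  have p0 : 0 < 1 / K₀ := by positivity
  have p1 : 0 < 1 / K₁ := one_div_pos.2 (hK₀.trans_le hK₁)
  have p2 : 0 < 1 / K₂ := one_div_pos.2 (hK₀.trans_le hK₂)
  have e1 := mul_le_mul hi1 hw1 hw0 p0.le
  have e2 := mul_le_mul hi2 h1 h0 p0.le
  have e3 : D.entropyBound / K₀ = 1 / K₀ * ∑ j, ((D.patterns j).card : ℝ) +
      1 / K₀ * ∑ i, ((D.sec i).card : ℝ) := by rw [entropyBound]; ring
  have e4 := mul_nonneg p1.le hw0
  have e5 := mul_nonneg p2.le h0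
  constructor <;> linarith

/-- Minimizers of an objective that is uniformly close to the cost are nearly optimal. -/
theorem near_optimal {X : Type*} {s : Set X} {c f : X → ℝ} {P η : ℝ} (hP : IsLeast (c '' s) P)
    (hlow : ∀ x ∈ s, c x - η ≤ f x) (hup : ∀ x ∈ s, f x ≤ c x) {x : X} (hx : x ∈ s)
    (hmin : ∀ y ∈ s, f x ≤ f y) : 0 ≤ c x - P ∧ c x - P ≤ η ∧ 0 ≤ P - f x ∧ P - f x ≤ η := by
  obtain ⟨y, hy, rfl⟩ := hP.1
  have h1 : c y ≤ c x := hP.2 ⟨x, hx, rfl⟩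
  have h2 := hmin y hy
  have h3 := hup y hy
  have h4 := hlow x hx
  refine ⟨?_, ?_, ?_, ?_⟩ <;> linarith

/-! ### Checks of degree at least three -/

theorem exists_two_others {D : JointDecoding N M S E} {i : Fin N} {j : Fin M}
    (h1 : (D.checkNbr j).card ≠ 1) (h2 : (D.checkNbr j).card ≠ 2) (hi : i ∈ D.checkNbr j) :
    ∃ a ∈ D.checkNbr j, ∃ b ∈ D.checkNbr j, a ≠ i ∧ b ≠ i ∧ a ≠ b := by
  have h : 1 < ((D.checkNbr j).erase i).card := by
    have := Finset.card_erase_add_one hi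
    omega
  obtain ⟨a, ha, b, hb, hab⟩ := Finset.one_lt_card.1 h
  rw [Finset.mem_erase] at ha hb
  exact ⟨a, ha.2, b, hb.2, ha.1, hb.1, hab⟩

/-- A direction in the space of pattern vectors that moves the marginal of bit `i` only. -/
theorem exists_marginal_direction {D : JointDecoding N M S E} {i : Fin N} {j : Fin M}
    (h1 : (D.checkNbr j).card ≠ 1) (h2 : (D.checkNbr j).card ≠ 2) (hi : i ∈ D.checkNbr j) :
    ∃ v : Finset (Fin N) → ℝ, (∀ B, B ∉ D.patterns j → v B = 0) ∧
      ∑ B ∈ D.patterns j, v B = 0 ∧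
      ∀ r, ∑ B ∈ D.patterns j with r ∈ B, v B = if r = i then 1 else 0 := by
  obtain ⟨a, ha, b, hb, hai, hbi, hab⟩ := exists_two_others h1 h2 hi
  have p1 := pair_mem_patterns hi ha hai.symm
  have p2 := pair_mem_patterns hi hb hbi.symm
  have p3 := pair_mem_patterns ha hb hab
  have p4 := D.empty_mem_patterns j
  -- Half a unit of mass moves onto each of `{i, a}` and `{i, b}`, and as much leaves `{a, b}` and
  -- `∅`; the marginals of `a` and `b` cancel.
  refine ⟨fun B => 1 / 2 * ((if B = {i, a} then 1 else 0) + (if B = {i, b} then 1 else 0) -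
    (if B = {a, b} then 1 else 0) - (if B = ∅ then 1 else 0)), fun B hB => ?_, ?_, fun r => ?_⟩
  · beta_reduce
    rw [if_neg (by rintro rfl; exact hB p1), if_neg (by rintro rfl; exact hB p2),
      if_neg (by rintro rfl; exact hB p3), if_neg (by rintro rfl; exact hB p4)]
    norm_num
  · rw [← Finset.mul_sum]
    simp only [Finset.sum_sub_distrib, Finset.sum_add_distrib, Finset.sum_ite_eq', p1, p2, p3, p4,
      if_true]
    norm_num
  · rw [← Finset.mul_sum]
    simp only [Finset.sum_sub_distrib, Finset.sum_add_distrib, Finset.sum_ite_eq',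
      Finset.mem_filter, p1, p2, p3, p4, true_and, Finset.mem_insert, Finset.mem_singleton,
      Finset.notMem_empty, if_false]
    by_cases hri : r = i
    · subst hri
      simp [hai.symm, hbi.symm]; norm_num
    · by_cases hra : r = a
      · subst hra
        simp [hri, hab]
      · by_cases hrb : r = b
        · subst hrb
          simp [hri, hra]
        · simp [hri, hra, hrb]

/-- Without checks of degree two, flows close to a feasible point with positive pattern variables
are feasible. -/
theorem eventually_exists_feasible {D : JointDecoding N M S E}
    (hcheck : ∀ j, (D.checkNbr j).card ≠ 1) (hcheck2 : ∀ j, (D.checkNbr j).card ≠ 2)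
    {g : Fin N → E → ℝ} {w : Fin M → Finset (Fin N) → ℝ} (hx : D.Feasible (g, w))
    (hw : ∀ j, ∀ B ∈ D.patterns j, 0 < w j B) {ι : Type*} {l : Filter ι} {u : ι → Fin N → E → ℝ}
    (hu : Tendsto u l (𝓝 g)) (hflow : ∀ n, D.IsFlow (u n))
    (hoff : ∀ n i e, e ∉ D.sec i → u n i e = 0) :
    ∀ᶠ n in l, ∃ w', D.Feasible (u n, w') := by
  choose v hv0 hvsum hvm using fun (j : Fin M) (i : D.checkNbr j) =>
    exists_marginal_direction (hcheck j) (hcheck2 j) i.2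
  -- Each marginal discrepancy is repaired along its own direction. The correction tends to zero, so
  -- positivity of `w` survives.
  let W : ι → Fin M → Finset (Fin N) → ℝ := fun n j B =>
    w j B + ∑ i : D.checkNbr j, (D.marg (u n) i - D.marg g i) * v j i B
  have hmarg : ∀ i, Tendsto (fun n => D.marg (u n) i) l (𝓝 (D.marg g i)) := fun i =>
    tendsto_finsetSum _ fun e _ => ((tendsto_pi_nhds.1 ((tendsto_pi_nhds.1 hu) i)) e)
  have hW : ∀ j B, Tendsto (fun n => W n j B) l (𝓝 (w j B)) := by
    intro j B
    have h := (tendsto_const_nhds (x := w j B)).add (tendsto_finsetSum (Finset.univ)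
      fun (i : D.checkNbr j) _ => (((hmarg i).sub_const (D.marg g i)).mul_const (v j i B)))
    simpa [W] using h
  have hpos : ∀ᶠ n in l, ∀ j, ∀ B, B ∈ D.patterns j → 0 ≤ W n j B := by
    refine eventually_all.2 fun j => eventually_all.2 fun B => ?_
    by_cases hB : B ∈ D.patterns j
    · filter_upwards [(hW j B).eventually (lt_mem_nhds (hw j B hB))] with n hn _ using hn.le
    · exact Eventually.of_forall fun n h => absurd h hB
  filter_upwards [hpos] with n hn
  refine ⟨W n, ?_, (hflow n).g_sum, ?_, (hflow n).flow, hn, (hflow n).g_nonneg, ?_, hoff n⟩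
  · intro j
    simp only [W]
    rw [Finset.sum_add_distrib, hx.w_sum j, Finset.sum_comm, Finset.sum_eq_zero, add_zero]
    intro i _
    rw [← Finset.mul_sum, hvsum, mul_zero]
  · intro i j hj
    simp only [W]
    rw [Finset.sum_add_distrib, hx.coupling i j hj, Finset.sum_comm]
    have h1 : ∀ r : D.checkNbr j, ∑ B ∈ D.patterns j with i ∈ B,
        (D.marg (u n) r - D.marg g r) * v j r B =
        if r = ⟨i, mem_bitNbr.1 hj⟩ then D.marg (u n) i - D.marg g i else 0 := by
      intro r
      rw [← Finset.mul_sum, hvm, mul_ite, mul_one, mul_zero]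
      by_cases hr : r = ⟨i, mem_bitNbr.1 hj⟩
      · subst hr; simp
      · rw [if_neg hr, if_neg fun h => hr (Subtype.ext h.symm)]
    rw [Finset.sum_congr rfl fun r _ => h1 r, Finset.sum_ite_eq' Finset.univ, if_pos (Finset.mem_univ _)]
    simp only [marg]
    ring
  · intro j B hB
    simp only [W]
    rw [show w j B = 0 from hx.w_off j B hB, zero_add]
    exact Finset.sum_eq_zero fun i _ => by rw [hv0 j i B hB, mul_zero]

theorem iter_off (D : JointDecoding N M S E) (K₁ K₂ : ℝ) (l : ℕ) {i : Fin N} {j : Fin M}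
    (hij : j ∉ D.bitNbr i) : D.iter K₁ K₂ l i j = 0 := by
  have hs : ∀ m, D.sweep K₁ K₂ m i j = m i j := by
    unfold sweep
    generalize List.finRange N = L
    induction L with
    | nil => intro m; rfl
    | cons p L ih =>
      intro m
      rw [List.foldl_cons, ih, bitUpdate, if_neg]
      rintro ⟨rfl, h⟩
      exact hij h
  induction l with
  | zero => rfl
  | succ l ih => rw [iter_succ, hs, ih]

/-- The empty pattern has weight one, so dividing by its belief removes the partition function. -/
theorem sum_pattern_eq_log (D : JointDecoding N M S E) {K₁ : ℝ} (hK₁ : 0 < K₁)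
    (m : Fin N → Fin M → ℝ) {j : Fin M} {B : Finset (Fin N)} (hB : B ∈ D.patterns j) :
    ∑ i ∈ B, m i j = -(1 / K₁) * Real.log (D.wOf K₁ m j B / D.wOf K₁ m j ∅) := by
  have hZ := D.checkPartition_pos K₁ m j
  rw [D.wOf_eq K₁ m j hB, D.wOf_eq K₁ m j (D.empty_mem_patterns j), div_div_div_cancel_right₀ hZ.ne',
    patWeight, patWeight, Finset.sum_empty, mul_zero, Real.exp_zero, div_one, Real.log_exp]
  field_simp

/-- Without checks of degree two, the messages converge when the pattern beliefs do. -/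
theorem exists_tendsto_iter {D : JointDecoding N M S E}
    (hcheck : ∀ j, (D.checkNbr j).card ≠ 1) (hcheck2 : ∀ j, (D.checkNbr j).card ≠ 2)
    {K₁ K₂ : ℝ} (hK₁ : 0 < K₁) {w : Fin M → Finset (Fin N) → ℝ}
    (hw : ∀ j, ∀ B ∈ D.patterns j, 0 < w j B)
    (hlim : Tendsto (fun l => D.wOf K₁ (D.iter K₁ K₂ l)) atTop (𝓝 w)) :
    ∃ m, Tendsto (fun l => D.iter K₁ K₂ l) atTop (𝓝 m) := by
  have hB : ∀ j, ∀ B ∈ D.patterns j, Tendsto (fun l => ∑ i ∈ B, D.iter K₁ K₂ l i j) atTop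
      (𝓝 (-(1 / K₁) * Real.log (w j B / w j ∅))) := by
    intro j B hB
    simp only [D.sum_pattern_eq_log hK₁ _ hB]
    have h := fun B => tendsto_pi_nhds.1 ((tendsto_pi_nhds.1 hlim) j) B
    have h0 := hw j ∅ (D.empty_mem_patterns j)
    exact (((h B).div (h ∅) h0.ne').log (div_pos (hw j B hB) h0).ne').const_mul _
  have key : ∀ i j, ∃ t, Tendsto (fun l => D.iter K₁ K₂ l i j) atTop (𝓝 t) := by
    intro i j
    by_cases hij : j ∈ D.bitNbr i
    · have hi := mem_bitNbr.1 hij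
      obtain ⟨a, ha, b, hb, hai, hbi, hab⟩ := exists_two_others (hcheck j) (hcheck2 j) hi
      -- Polarization: the message of `i` is half of the pair sums over `{i, a}` and `{i, b}` minus
      -- that over `{a, b}`.
      refine ⟨_, ((((hB j _ (pair_mem_patterns hi ha hai.symm)).add
        (hB j _ (pair_mem_patterns hi hb hbi.symm))).sub
          (hB j _ (pair_mem_patterns ha hb hab))).const_mul (1 / 2)).congr fun l => ?_⟩
      rw [Finset.sum_pair hai.symm, Finset.sum_pair hbi.symm, Finset.sum_pair hab]
      ring
    · exact ⟨0, by simp only [D.iter_off K₁ K₂ _ hij]; exact tendsto_const_nhds⟩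
  choose m hm using key
  exact ⟨m, tendsto_pi_nhds.2 fun i => tendsto_pi_nhds.2 fun j => hm i j⟩

end JointDecoding

/-! ### Assembly of the main theorem -/

open JointDecoding in
theorem mainTheorem1 {N M : ℕ} {S E : Type*} [Fintype S] [DecidableEq S]
    (D : JointDecoding N M S E) (hN : 0 < N)
    (htrellis : D.AcceptsAllInputs)
    (hcheck : ∀ j, (D.checkNbr j).card ≠ 1) :
    ∃ Pstar : ℝ, IsLeast ((fun x => D.cost x.1) '' D.feasibleSet) Pstar ∧
    ∀ δ : ℝ, 0 < δ → ∃ K₀ : ℝ, 0 < K₀ ∧ ∀ K₁ K₂ : ℝ, K₀ ≤ K₁ → K₀ ≤ K₂ →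
      -- Problem-PS has a unique optimal solution, and its value is the maximum of Problem-DS
      (∃ (g : Fin N → E → ℝ) (w : Fin M → Finset (Fin N) → ℝ) (Pt : ℝ),
        (g, w) ∈ D.feasibleSet ∧ D.psObj K₁ K₂ (g, w) = Pt ∧
        (∀ x ∈ D.feasibleSet, x ≠ (g, w) → Pt < D.psObj K₁ K₂ x) ∧
        (∀ p, IsGreatest (Set.range (D.dsObj K₁ K₂ p)) Pt) ∧
        -- the optimal solution is nearly optimal for Problem-P, and the two values are close
        0 ≤ (D.cost g - Pstar) / N ∧ (D.cost g - Pstar) / N ≤ δ ∧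
        0 ≤ (Pstar - Pt) / N ∧ (Pstar - Pt) / N ≤ δ ∧
        -- the algorithm converges to the maximum of Problem-DS and yields this solution
        ((∀ i, ((D.bitNbr i).card : ℝ) * K₂ < K₁) →
          (∀ p, Tendsto (fun l => D.dsObj K₁ K₂ p (D.iter K₁ K₂ l)) atTop (𝓝 Pt)) ∧
          Tendsto (fun l => D.gOf K₂ (D.iter K₁ K₂ l)) atTop (𝓝 g) ∧
          Tendsto (fun l => D.wOf K₁ (D.iter K₁ K₂ l)) atTop (𝓝 w) ∧
          -- without checks of degree two, the messages converge, and finitely many iterations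
          -- already give a feasible and nearly optimal point
          ((∀ j, (D.checkNbr j).card ≠ 2) →
            (∃ m, (∀ p, D.dsObj K₁ K₂ p m = Pt) ∧
              Tendsto (fun l => D.iter K₁ K₂ l) atTop (𝓝 m)) ∧
            ∀ᶠ l in atTop,
              (∃ w', (D.gOf K₂ (D.iter K₁ K₂ l), w') ∈ D.feasibleSet) ∧
              0 ≤ (D.cost (D.gOf K₂ (D.iter K₁ K₂ l)) - Pstar) / N ∧
              (D.cost (D.gOf K₂ (D.iter K₁ K₂ l)) - Pstar) / N ≤ δ))) ∧
      -- the same closeness when only the entropy of one section is kept in Problem-PS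
      (∀ p, ∃ Pp : ℝ, IsLeast (D.psObjAt K₁ K₂ p '' D.feasibleSet) Pp ∧
        0 ≤ (Pstar - Pp) / N ∧ (Pstar - Pp) / N ≤ δ ∧
        ∀ x ∈ D.feasibleSet, D.psObjAt K₁ K₂ p x = Pp →
          0 ≤ (D.cost x.1 - Pstar) / N ∧ (D.cost x.1 - Pstar) / N ≤ δ) := by
  -- A feasible point is read off from the dual maximizer at `K₁ = K₂ = 1`.
  have hne : D.feasibleSet.Nonempty := by
    obtain ⟨m, hm⟩ := exists_forall_dual_le htrellis hN hcheck one_pos one_pos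
    exact ⟨_, (isStationary_of_forall_dual_le htrellis hcheck one_pos one_pos hm).feasible
      htrellis hcheck⟩
  have hcompact := D.isCompact_feasibleSet
  have hcostc : Continuous fun x : (Fin N → E → ℝ) × (Fin M → Finset (Fin N) → ℝ) => D.cost x.1 :=
    D.continuous_cost.comp continuous_fst
  obtain ⟨P, hP⟩ := (hcompact.image hcostc).exists_isLeast (hne.image _)
  refine ⟨P, hP, fun δ hδ => ?_⟩
  have hC := D.entropyBound_nonneg
  have hNr : (1 : ℝ) ≤ N := by exact_mod_cast hN
  have hNpos : (0 : ℝ) < N := by linarith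
  -- Makes the entropy error strictly less than `δ`, also when the bound is zero. The strict
  -- inequality leaves room for the finite iterates.
  set K₀ : ℝ := 2 * D.entropyBound / δ + 1 with hK₀def
  have hK₀ : 0 < K₀ := by positivity
  have hη : D.entropyBound / K₀ < δ := by
    rw [div_lt_iff₀ hK₀, hK₀def, mul_add, mul_div_cancel₀ _ hδ.ne']
    linarith
  have hδN : δ ≤ δ * N := le_mul_of_one_le_right hδ.le hNr
  refine ⟨K₀, hK₀, fun K₁ K₂ h1 h2 => ⟨?_, fun p => ?_⟩⟩
  · have hK₁ := hK₀.trans_le h1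
    have hK₂ := hK₀.trans_le h2
    obtain ⟨m, hm⟩ := exists_forall_dual_le htrellis hN hcheck hK₁ hK₂
    have hst := isStationary_of_forall_dual_le htrellis hcheck hK₁ hK₂ hm
    have hfeas := hst.feasible htrellis hcheck
    have hdual := hst.dual_eq htrellis hcheck hN hK₁ hK₂
    have hweak := fun x (hx : x ∈ D.feasibleSet) =>
      Feasible.dual_le htrellis hN hK₁ hK₂ hx m
    -- Beliefs at stationary messages are feasible and attain the dual value, so the case of
    -- equality in weak duality identifies them with those at `m`.
    have huniq : ∀ n, D.IsStationary K₁ K₂ n → D.dual K₁ K₂ n = D.dual K₁ K₂ m ∧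
        D.gOf K₂ n = D.gOf K₂ m ∧ D.wOf K₁ n = D.wOf K₁ m := by
      intro n hn
      have hfn := hn.feasible htrellis hcheck
      have hdn := hn.dual_eq htrellis hcheck hN hK₁ hK₂
      have heq : D.dual K₁ K₂ n = D.dual K₁ K₂ m :=
        le_antisymm (hm n) (hdn ▸ (hweak _ hfn).1)
      have hx := (hweak _ hfn).2.1 (heq.symm.trans hdn)
      exact ⟨heq, congrArg Prod.fst hx, congrArg Prod.snd hx⟩
    have hnear := near_optimal (f := D.psObj K₁ K₂) hP
      (fun x hx => (Feasible.sub_entropies_mem hx hK₀ h1 h2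
        ((Feasible.isFlow hx).trellisEntropy_nonneg hN) (Feasible.isFlow hx).trellisEntropy_le).1)
      (fun x hx => (Feasible.sub_entropies_mem hx hK₀ h1 h2
        ((Feasible.isFlow hx).trellisEntropy_nonneg hN) (Feasible.isFlow hx).trellisEntropy_le).2)
      hfeas (fun y hy => hdual ▸ (hweak y hy).1)
    rw [← hdual] at hnear
    obtain ⟨n1, n2, n3, n4⟩ := hnear
    simp only at n1 n2
    refine ⟨D.gOf K₂ m, D.wOf K₁ m, D.dual K₁ K₂ m, hfeas, hdual.symm, ?_, ?_,
      div_nonneg n1 hNpos.le, (div_le_iff₀ hNpos).2 (by linarith),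
      div_nonneg n3 hNpos.le, (div_le_iff₀ hNpos).2 (by linarith), fun hK => ?_⟩
    · exact fun x hx hxne => lt_of_le_of_ne (hweak x hx).1 fun h => hxne ((hweak x hx).2.1 h)
    · refine fun p => ⟨⟨m, D.dsObj_eq_dual K₁ K₂ p m⟩, ?_⟩
      rintro _ ⟨m', rfl⟩
      rw [D.dsObj_eq_dual]
      exact hm m'
    have hlimD : Tendsto (fun l => D.dual K₁ K₂ (D.iter K₁ K₂ l)) atTop (𝓝 (D.dual K₁ K₂ m)) :=
      tendsto_iter htrellis hN hcheck hK₁ hK₂ hK (continuous_dual htrellis hN K₁ K₂)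
        (fun _ _ h => dual_eq_of_natParam_eq h K₁ K₂) fun n hn => (huniq n hn).1
    have hlimg : Tendsto (fun l => D.gOf K₂ (D.iter K₁ K₂ l)) atTop (𝓝 (D.gOf K₂ m)) :=
      tendsto_iter htrellis hN hcheck hK₁ hK₂ hK (continuous_gOf htrellis K₂)
        (fun _ _ h => gOf_eq_of_natParam_eq htrellis h K₂) fun n hn => (huniq n hn).2.1
    have hlimw : Tendsto (fun l => D.wOf K₁ (D.iter K₁ K₂ l)) atTop (𝓝 (D.wOf K₁ m)) :=
      tendsto_iter htrellis hN hcheck hK₁ hK₂ hK (D.continuous_wOf K₁)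
        (fun _ _ h => wOf_eq_of_natParam_eq h K₁) fun n hn => (huniq n hn).2.2
    refine ⟨fun p => ?_, hlimg, hlimw, fun hcheck2 => ?_⟩
    · simp only [D.dsObj_eq_dual]
      exact hlimD
    have hwpos : ∀ j, ∀ B ∈ D.patterns j, 0 < D.wOf K₁ m j B := fun j B hB => by
      rw [D.wOf_eq K₁ m j hB]
      exact div_pos (patWeight_pos K₁ m j B) (D.checkPartition_pos K₁ m j)
    constructor
    -- The limit is not claimed to be `m`; its dual value, by continuity, shows that it is a
    -- maximizer.
    · obtain ⟨m', hm'⟩ := exists_tendsto_iter hcheck hcheck2 hK₁ hwpos hlimw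
      refine ⟨m', fun p => ?_, hm'⟩
      rw [D.dsObj_eq_dual]
      exact tendsto_nhds_unique (((continuous_dual htrellis hN K₁ K₂).tendsto m').comp hm') hlimD
    · have hev := eventually_exists_feasible hcheck hcheck2 hfeas hwpos hlimg
        (fun l => htrellis.isFlow_gOf K₂ _) (fun l i e he => by simp [gOf, he])
      have hcost := ((D.continuous_cost.tendsto _).comp hlimg).eventually
        (gt_mem_nhds (show D.cost (D.gOf K₂ m) < P + δ by linarith))
      filter_upwards [hev, hcost] with l hl hl'
      obtain ⟨w', hw'⟩ := hl
      have hge : P ≤ D.cost (D.gOf K₂ (D.iter K₁ K₂ l)) := hP.2 ⟨_, hw', rfl⟩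
      simp only [Function.comp_apply] at hl'
      exact ⟨⟨w', hw'⟩, div_nonneg (by linarith) hNpos.le, (div_le_iff₀ hNpos).2 (by linarith)⟩
  · obtain ⟨Q, hQ⟩ := (hcompact.image (D.continuous_psObjAt K₁ K₂ p)).exists_isLeast (hne.image _)
    have hnear := fun x (hx : x ∈ D.feasibleSet) (hxQ : D.psObjAt K₁ K₂ p x = Q) =>
      near_optimal (f := D.psObjAt K₁ K₂ p) hP
        (fun x hx => (Feasible.sub_entropies_mem hx hK₀ h1 h2
          ((Feasible.isFlow hx).sectionEntropy_nonneg p)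
          ((Feasible.isFlow hx).sectionEntropy_le p |>.trans (Finset.single_le_sum
            (f := fun i => ((D.sec i).card : ℝ)) (fun _ _ => Nat.cast_nonneg _)
            (Finset.mem_univ p)))).1)
        (fun x hx => (Feasible.sub_entropies_mem hx hK₀ h1 h2
          ((Feasible.isFlow hx).sectionEntropy_nonneg p)
          ((Feasible.isFlow hx).sectionEntropy_le p |>.trans (Finset.single_le_sum
            (f := fun i => ((D.sec i).card : ℝ)) (fun _ _ => Nat.cast_nonneg _)
            (Finset.mem_univ p)))).2)
        hx (fun y hy => hxQ ▸ hQ.2 ⟨y, hy, rfl⟩)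
    obtain ⟨x₀, hx₀, hx₀Q⟩ := hQ.1
    obtain ⟨-, -, n3, n4⟩ := hnear x₀ hx₀ hx₀Q
    rw [hx₀Q] at n3 n4
    refine ⟨Q, hQ, div_nonneg n3 hNpos.le, (div_le_iff₀ hNpos).2 (by linarith), fun x hx hxQ => ?_⟩
    obtain ⟨n1, n2, -, -⟩ := hnear x hx hxQ
    exact ⟨div_nonneg n1 hNpos.le, (div_le_iff₀ hNpos).2 (by linarith)⟩
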